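/- A topograph is a tree drawn in the plane, all of whose vertices have degree $3$, whose complementary regions are labelled by integers such that, whenever regions $s,t$ lie on the two sides of an edge and regions $r,u$ lie at its two ends, the labels satisfy $r+u=2(s+t)$. Two topographs are the same if there is a label-preserving and orientation-preserving isomorphism between them. The discriminant of a topograph is $D=r^2+s^2+t^2-2rs-2rt-2st$, where $r,s,t$ are the labels of the three regions at a vertex; the topograph is primitive if $\gcd(r,s,t)=1$ (neither depends on the vertex). A directed edge with label $a$ on its left, label $c$ on its right and label $u$ at its far end has configuration $[a,b,c]$ with $b=u-(a+c)$. It is a rightward directed river edge if $a>0>c$. In a topograph of non-square discriminant $D>0$, start at any rightward directed river edge, move forward along the river (so that every directed edge reached is again a rightward directed river edge), and record the left turns ($L=0$) and right turns ($R=1$) until the initial configuration $[a,b,c]$ occurs again for the first time. The resulting finite binary word is the river sequence. A binary necklace is a finite binary word up to cyclic permutation; it is repeating if it consists of $k\ge 2$ identical consecutive blocks. Theorem. Every primitive topograph of non-square discriminant $D>0$ has a rightward directed river edge; the river sequence from each such edge exists and is unique; and the river sequences from all such edges of one topograph represent one and the same binary necklace. Assigning this necklace to the topograph gives a bijection from the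 set of all primitive topographs (up to sameness) whose discriminant is positive and not a square (over all such $D$) to the set of non-repeating binary necklaces of length at least $2$. -/

import Mathlib

/-- A tree drawn in the plane, all of whose vertices have degree `3`, presented combinatorially:
a tree together with the counterclockwise cyclic order of the three edges at every vertex.
A `Dart` is a directed edge, and `rot d` is the next directed edge out of the vertex `d.fst`
after `d`, in counterclockwise direction. (Such a tree is countable, so vertices in `Type`
are no restriction.) -/
structure PlaneCubicTree where
  V : Type
  G : SimpleGraph V
  isTree : G.IsTree
  degree_three : ∀ v : V, (G.neighborSet v).ncard = 3
  rot : Equiv.Perm G.Dart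
  rot_fst : ∀ d : G.Dart, (rot d).fst = d.fst
  rot_cyclic : ∀ d d' : G.Dart, d.fst = d'.fst → rot.SameCycle d d'

namespace PlaneCubicTree

variable (T : PlaneCubicTree)

/-- Reversal of directed edges. -/
def rev : Equiv.Perm T.G.Dart :=
  Function.Involutive.toPerm SimpleGraph.Dart.symm SimpleGraph.Dart.symm_involutive

/-- Move forward along a directed edge and then turn left. Arriving along `d` at its end, the three
outgoing directed edges are, counterclockwise: `rev d`, the right turn, the left turn. -/
def left : Equiv.Perm T.G.Dart := T.rev.trans T.rot.symm

/-- Move forward along a directed edge and then turn right. -/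
def right : Equiv.Perm T.G.Dart := T.rev.trans T.rot

/-- The regions into which the tree divides the plane. Going along the border of a region, with
the region on the left, means turning left at every vertex; so a region is an orbit of
`left`. -/
def Region : Type := Quotient (Equiv.Perm.SameCycle.setoid T.left)

variable {T}

/-- The region on the left of a directed edge. -/
def leftRegion (d : T.G.Dart) : T.Region := Quotient.mk _ d

/-- The region on the right of a directed edge. -/
def rightRegion (d : T.G.Dart) : T.Region := leftRegion (T.rev d)

/-- The region straight ahead of a directed edge: it lies at its end, between the left turn and
the right turn. -/
def aheadRegion (d : T.G.Dart) : T.Region := leftRegion (T.right d)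

/-- The region behind a directed edge. -/
def behindRegion (d : T.G.Dart) : T.Region := aheadRegion (T.rev d)

/-- One step along the tree: `false` stands for the letter `L = 0`, a left turn, and `true` for the
letter `R = 1`, a right turn. -/
def step (d : T.G.Dart) : Bool → T.G.Dart
  | false => T.left d
  | true => T.right d

/-- The directed edge reached from `d` by a finite sequence of left and right turns. -/
def follow (d : T.G.Dart) (w : List Bool) : T.G.Dart := w.foldl step d

end PlaneCubicTree

open PlaneCubicTree in
/-- An integer topograph: the regions of a plane cubic tree are labelled by integers so that around
each edge, with regions `s`, `t` on its two sides and regions `r`, `u` at its two ends,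
`r + u = 2 (s + t)`. -/
structure Topograph where
  tree : PlaneCubicTree
  label : tree.Region → ℤ
  rule : ∀ d : tree.G.Dart, label (behindRegion d) + label (aheadRegion d) =
    2 * (label (leftRegion d) + label (rightRegion d))

namespace Topograph

open PlaneCubicTree

/-- Two topographs are the same if there is a graph isomorphism between them that preserves the
orientation and the labels. -/
def Same (T T' : Topograph) : Prop :=
  ∃ φ : T.tree.G ≃g T'.tree.G,
    (∀ d, φ.toHom.mapDart (T.tree.rot d) = T'.tree.rot (φ.toHom.mapDart d)) ∧
    (∀ d, T'.label (leftRegion (φ.toHom.mapDart d)) = T.label (leftRegion d))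

theorem same_refl (T : Topograph) : T.Same T :=
  ⟨SimpleGraph.Iso.refl, fun _ => rfl, fun _ => rfl⟩

theorem Same.symm {T T' : Topograph} (h : T.Same T') : T'.Same T := by
  obtain ⟨φ, h1, h2⟩ := h
  have e : ∀ d, φ.toHom.mapDart (φ.symm.toHom.mapDart d) = d := fun d =>
    SimpleGraph.Dart.ext _ _ (Prod.ext (φ.apply_symm_apply _) (φ.apply_symm_apply _))
  have e' : ∀ d, φ.symm.toHom.mapDart (φ.toHom.mapDart d) = d := fun d =>
    SimpleGraph.Dart.ext _ _ (Prod.ext (φ.symm_apply_apply _) (φ.symm_apply_apply _))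
  refine ⟨φ.symm, fun d => ?_, fun d => ?_⟩
  · rw [← e' (T.tree.rot _), h1, e]
  · rw [← h2, e]

theorem Same.trans {T T' T'' : Topograph} (h : T.Same T') (h' : T'.Same T'') : T.Same T'' := by
  obtain ⟨φ, h1, h2⟩ := h
  obtain ⟨ψ, k1, k2⟩ := h'
  have e : ∀ d, SimpleGraph.Hom.mapDart (SimpleGraph.Iso.toHom (φ.trans ψ)) d =
      ψ.toHom.mapDart (φ.toHom.mapDart d) := fun d => rfl
  refine ⟨φ.trans ψ, fun d => ?_, fun d => ?_⟩
  · rw [e, e, h1, k1]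
  · rw [e, k2, h2]

instance setoid : Setoid Topograph :=
  ⟨Same, same_refl, Same.symm, Same.trans⟩

variable (T : Topograph)

/-- The three regions that meet at the vertex `d.fst` have labels `T.vertexLabel d 0`,
`T.vertexLabel d 1`, `T.vertexLabel d 2`. -/
def vertexLabel (d : T.tree.G.Dart) (i : ℕ) : ℤ := T.label (leftRegion ((T.tree.rot ^ i) d))

/-- `D` is the discriminant of the topograph: `D = r² + s² + t² - 2rs - 2rt - 2st` for the labels
`r, s, t` of the regions at any vertex. -/
def HasDiscriminant (D : ℤ) : Prop :=
  ∀ d : T.tree.G.Dart,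
    D = T.vertexLabel d 0 ^ 2 + T.vertexLabel d 1 ^ 2 + T.vertexLabel d 2 ^ 2
      - 2 * T.vertexLabel d 0 * T.vertexLabel d 1 - 2 * T.vertexLabel d 0 * T.vertexLabel d 2
      - 2 * T.vertexLabel d 1 * T.vertexLabel d 2

/-- A topograph is primitive if the gcd of the labels of the regions at any vertex is `1`. -/
def IsPrimitive : Prop :=
  ∀ d : T.tree.G.Dart,
    Int.gcd (Int.gcd (T.vertexLabel d 0) (T.vertexLabel d 1)) (T.vertexLabel d 2) = 1

/-- The label of a directed edge: the common difference of the arithmetic progression formed by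
the label behind, the sum of the labels on both sides, and the label ahead. -/
def edgeLabel (d : T.tree.G.Dart) : ℤ :=
  T.label (aheadRegion d) - (T.label (leftRegion d) + T.label (rightRegion d))

/-- The configuration `[a, b, c]` at a directed edge, which stands for the binary quadratic form
`a x² + b x y + c y²`: the label on the left, that of the edge, and the label on the right. -/
def config (d : T.tree.G.Dart) : ℤ × ℤ × ℤ :=
  (T.label (leftRegion d), T.edgeLabel d, T.label (rightRegion d))

/-- The edge of `d` belongs to the river, that is, it has a positive region on one side and a
negative region on the other, and `d` is directed rightwards, that is, with the positive region
on its left (above the river). Equivalently its form `[a, b, c]` is simple: `a > 0 > c`. -/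
def IsRiverEdge (d : T.tree.G.Dart) : Prop :=
  0 < T.label (leftRegion d) ∧ T.label (rightRegion d) < 0

/-- `w` is the river sequence recorded from the rightward river edge `d`: the nonempty sequence of
turns made by moving rightwards along the river, from `d` until the first time that the
form at `d` occurs again. -/
def IsRiverSequence (d : T.tree.G.Dart) (w : List Bool) : Prop :=
  w ≠ [] ∧
  (∀ k ≤ w.length, T.IsRiverEdge (follow d (w.take k))) ∧
  T.config (follow d w) = T.config d ∧
  ∀ k, 0 < k → k < w.length → T.config (follow d (w.take k)) ≠ T.config d

end Topograph

/-- Primitive topographs whose discriminant is positive and not a square. -/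
def PrimitiveNonsquareTopograph : Type 1 :=
  {T : Topograph // T.IsPrimitive ∧ ∃ D : ℤ, 0 < D ∧ ¬ IsSquare D ∧ T.HasDiscriminant D}

instance PrimitiveNonsquareTopograph.setoid : Setoid PrimitiveNonsquareTopograph :=
  Topograph.setoid.comap Subtype.val

/-- A binary necklace (a binary word up to cyclic permutation) is repeating if it is made of at
least two identical parts. -/
def IsRepeating (N : Cycle Bool) : Prop :=
  ∃ (u : List Bool) (k : ℕ), 2 ≤ k ∧ N = ((List.replicate k u).flatten : List Bool)

/-- Non-repeating binary necklaces of length at least `2`. -/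
def NonrepeatingNecklace : Type :=
  {N : Cycle Bool // 2 ≤ N.length ∧ ¬ IsRepeating N}

/-! A topograph is encoded by the form `[a, b, c]` at one directed edge. The form determines the
labels everywhere, since every plane cubic tree is isomorphic to one model tree whose vertices are
finite sequences of turns (`exists_iso`, `ofForm_same`), and conversely every form labels the model
tree (`ofForm`). Turns act on forms by the unimodular substitutions `!![1, 1; 0, 1]` (left) and
`!![1, 0; 1, 1]` (right).

Rightward river edges carry the simple forms, `a > 0 > c`. When the discriminant is not a square no
label is zero, so exactly one turn stays on the river: the dynamics `next`. There are finitely many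
simple forms of given discriminant and `next` is injective on them, so each is periodic, and the
river sequence is the word of one minimal period. A descent on `|a| + |c|` finds the river. A turn
off the river gives coefficients of equal sign, which persists; so all rightward river edges have
forms in one `next`-orbit, and their words are rotations of each other.

The rest is linear algebra. A closed path with word `w` and matrix `N` fixes its form, and the forms
fixed by `N` are proportional to `fixedForm N` when `N 1 0 ≠ 0` (`smul_eq_smul_fixedForm`).
Non-repeating: if `w` is a power of `u`, the matrix of `u` commutes with `N`, hence fixes the same
form, which would recur too early. Injective: two primitive simple forms with the same word are
proportional with positive leading coefficients, hence equal (`eq_of_act_eq`). Surjective: a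
non-repeating word of length at least `2` contains both letters, so `fixedForm N` is simple, and its
discriminant `(tr N)² - 4` is not a square. Divided by its content it is a primitive form whose
river sequence is `w` (`exists_riverWord_eq`). -/

/-- Integer triples `[a, b, c]`, standing for the binary quadratic forms `a x² + b x y + c y²`. -/
abbrev IntForm : Type := ℤ × ℤ × ℤ

/-! ### Binary quadratic forms and the periodic dynamics on the river. -/

namespace IntForm

open Function

/-- The discriminant `b² - 4 a c`. -/
def disc (f : IntForm) : ℤ := f.2.1 ^ 2 - 4 * f.1 * f.2.2

/-- The form at the next edge after a left turn (`false`) or a right turn (`true`). -/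
def step (f : IntForm) : Bool → IntForm
  | false => (f.1, 2 * f.1 + f.2.1, f.1 + f.2.1 + f.2.2)
  | true => (f.1 + f.2.1 + f.2.2, f.2.1 + 2 * f.2.2, f.2.2)

/-- The form reached after a sequence of turns. -/
def act (f : IntForm) (w : List Bool) : IntForm := w.foldl step f

/-- The form at the reversed edge. -/
def swap (f : IntForm) : IntForm := (f.2.2, -f.2.1, f.1)

/-- A form `[a, b, c]` is simple if `a > 0 > c`. -/
def Simple (f : IntForm) : Prop := 0 < f.1 ∧ f.2.2 < 0

/-- A form is primitive if its coefficients have no common divisor except units. -/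
def Primitive (f : IntForm) : Prop := ∀ n : ℤ, n ∣ f.1 → n ∣ f.2.1 → n ∣ f.2.2 → IsUnit n

/-- The forms at the river edges: simple of nonsquare discriminant. -/
def River (f : IntForm) : Prop := f.Simple ∧ ¬ IsSquare f.disc

/-- The turn that stays on the river. -/
def turn (f : IntForm) : Bool := decide (0 < f.1 + f.2.1 + f.2.2)

/-- The next form on the river. -/
def next (f : IntForm) : IntForm := f.step f.turn

@[simp] theorem act_nil (f : IntForm) : f.act [] = f := rfl

@[simp] theorem act_cons (f : IntForm) (x : Bool) (w : List Bool) :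
    f.act (x :: w) = (f.step x).act w := rfl

theorem act_append (f : IntForm) (u v : List Bool) : f.act (u ++ v) = (f.act u).act v :=
  List.foldl_append

@[simp] theorem disc_step (f : IntForm) (x : Bool) : (f.step x).disc = f.disc := by
  cases x <;> simp only [disc, step] <;> ring

@[simp] theorem disc_swap (f : IntForm) : f.swap.disc = f.disc := by
  simp only [disc, swap]; ring

@[simp] theorem swap_swap (f : IntForm) : f.swap.swap = f := by
  simp [swap]

@[simp] theorem disc_act (f : IntForm) (w : List Bool) : (f.act w).disc = f.disc := by
  induction w generalizing f with
  | nil => rfl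
  | cons x w ih => rw [act_cons, ih, disc_step]

/-- With `a = 0` the discriminant would be `b²`. Applied after a turn, this excludes the label zero
ahead as well. -/
theorem fst_ne_zero {f : IntForm} (hf : ¬ IsSquare f.disc) : f.1 ≠ 0 := fun h =>
  hf ⟨f.2.1, by simp only [disc, h]; ring⟩

theorem snd_snd_ne_zero {f : IntForm} (hf : ¬ IsSquare f.disc) : f.2.2 ≠ 0 := fun h =>
  hf ⟨f.2.1, by simp only [disc, h]; ring⟩

theorem sum_ne_zero {f : IntForm} (hf : ¬ IsSquare f.disc) : f.1 + f.2.1 + f.2.2 ≠ 0 :=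
  fst_ne_zero (f := f.step true) (by rwa [disc_step])

theorem turn_eq_false {f : IntForm} (hf : ¬ IsSquare f.disc) :
    f.turn = false ↔ f.1 + f.2.1 + f.2.2 < 0 := by
  have := sum_ne_zero hf
  simp only [turn, decide_eq_false_iff_not]
  omega

theorem turn_eq_true {f : IntForm} : f.turn = true ↔ 0 < f.1 + f.2.1 + f.2.2 := by
  simp [turn]

theorem River.next {f : IntForm} (hf : f.River) : f.next.River := by
  refine ⟨?_, by rw [IntForm.next, disc_step]; exact hf.2⟩
  cases h : f.turn
  · rw [IntForm.next, h]
    exact ⟨hf.1.1, (turn_eq_false hf.2).1 h⟩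
  · rw [IntForm.next, h]
    exact ⟨turn_eq_true.1 h, hf.1.2⟩

theorem River.iterate {f : IntForm} (hf : f.River) (n : ℕ) : (IntForm.next^[n] f).River := by
  induction n with
  | zero => exact hf
  | succ n ih => rw [iterate_succ_apply']; exact ih.next

/-- The region ahead comes to lie on the right after a left turn and on the left after a right turn,
so the sign of its label `a + b + c` dictates the turn. -/
theorem eq_turn_of_simple_step {f : IntForm} {x : Bool} (h : (f.step x).Simple) : x = f.turn := by
  cases x
  · have h2 : f.1 + f.2.1 + f.2.2 < 0 := h.2
    simp only [turn]
    symm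
    rw [decide_eq_false_iff_not]
    omega
  · have h2 : 0 < f.1 + f.2.1 + f.2.2 := h.1
    simp [turn, h2]

/-- The last turn can be read off from the label behind the new edge: it was the old `c < 0` if the
turn was left, and the old `a > 0` if it was right. Each single turn is invertible. -/
theorem River.next_injective {f g : IntForm} (hf : f.River) (hg : g.River)
    (h : f.next = g.next) : f = g := by
  obtain ⟨⟨hf1, hf2⟩, -⟩ := hf
  obtain ⟨⟨hg1, hg2⟩, -⟩ := hg
  obtain ⟨a, b, c⟩ := f
  obtain ⟨a', b', c'⟩ := g
  simp only [IntForm.next] at h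
  cases hx : turn (a, b, c) <;> cases hy : turn (a', b', c') <;>
    simp only [hx, hy, step, Prod.mk.injEq] at h ⊢ <;> simp only at hf1 hf2 hg1 hg2 <;> omega

/-- In `D = b² + 4 a (-c)` both summands are nonnegative and `a`, `-c` are positive, so `D` bounds
all three coefficients. -/
theorem finite_river (D : ℤ) : {f : IntForm | f.Simple ∧ f.disc = D}.Finite := by
  refine ((Set.finite_Icc (-D) D).prod ((Set.finite_Icc (-D) D).prod
    (Set.finite_Icc (-D) D))).subset ?_
  rintro ⟨a, b, c⟩ ⟨⟨h1, h2⟩, h3⟩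
  simp only [disc] at h1 h2 h3
  have hb : |b| ≤ b ^ 2 := by
    rw [← sq_abs]; rcases (abs_nonneg b).eq_or_lt with h | h
    · rw [← h]; norm_num
    · nlinarith
  have hb' := abs_le.1 (show |b| ≤ D by nlinarith)
  simp only [Set.mem_prod, Set.mem_Icc]
  refine ⟨⟨?_, ?_⟩, ⟨?_, ?_⟩, ⟨?_, ?_⟩⟩ <;> nlinarith [sq_nonneg b]

theorem River.mem_periodicPts {f : IntForm} (hf : f.River) : f ∈ periodicPts IntForm.next := by
  have hfin := finite_river f.disc
  have hmaps : ∀ n ∈ (Set.univ : Set ℕ), (IntForm.next^[n] f) ∈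
      {g : IntForm | g.Simple ∧ g.disc = f.disc} := by
    rintro n -
    refine ⟨(hf.iterate n).1, ?_⟩
    induction n with
    | zero => rfl
    | succ n ih => rw [iterate_succ_apply', IntForm.next, disc_step]; exact ih
  obtain ⟨m, -, n, -, hmn, h⟩ := Set.infinite_univ.exists_lt_map_eq_of_mapsTo hmaps hfin
  -- Pigeonhole gives a repetition somewhere on the orbit; injectivity cancels the steps before it,
  -- so that `f` itself recurs.
  have key : ∀ m k, IntForm.next^[m] f = IntForm.next^[m + k] f → f = IntForm.next^[k] f := by
    intro m k
    induction m with
    | zero => simp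
    | succ m ih =>
      intro h
      apply ih
      rw [show m + 1 + k = (m + k) + 1 by ring, iterate_succ_apply', iterate_succ_apply'] at h
      exact (hf.iterate m).next_injective (hf.iterate _) h
  refine mk_mem_periodicPts (n := n - m) (by omega) (key m (n - m) ?_).symm
  rw [h]; congr 1; omega

/-! ### Words of turns along the river. -/

/-- The sequence of the first `n` turns along the river. -/
def word (f : IntForm) (n : ℕ) : List Bool := (List.range n).map fun i => (next^[i] f).turn

@[simp] theorem length_word (f : IntForm) (n : ℕ) : (f.word n).length = n := by simp [word]

theorem word_succ (f : IntForm) (n : ℕ) : f.word (n + 1) = f.turn :: f.next.word n := by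
  simp [word, List.range_succ_eq_map, Function.comp_def]

theorem word_add (f : IntForm) (m n : ℕ) :
    f.word (m + n) = f.word m ++ (next^[m] f).word n := by
  induction m generalizing f with
  | zero => simp [word]
  | succ m ih => rw [show m + 1 + n = (m + n) + 1 by ring, word_succ, word_succ, ih]; rfl

@[simp] theorem act_word (f : IntForm) (n : ℕ) : f.act (f.word n) = next^[n] f := by
  induction n generalizing f with
  | zero => rfl
  | succ n ih => rw [word_succ, act_cons, iterate_succ_apply]; exact ih f.next

theorem take_word (f : IntForm) {k n : ℕ} (h : k ≤ n) : (f.word n).take k = f.word k := by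
  obtain ⟨m, rfl⟩ := Nat.exists_eq_add_of_le h
  rw [word_add, List.take_left']
  simp

theorem eq_word {f : IntForm} {w : List Bool} (h : ∀ k ≤ w.length, (f.act (w.take k)).Simple) :
    w = f.word w.length := by
  induction w generalizing f with
  | nil => rfl
  | cons x w ih =>
    have hx : x = f.turn := eq_turn_of_simple_step (h 1 (by simp))
    rw [List.length_cons, word_succ, ← hx]
    congr 1
    rw [next, ← hx]
    exact ih fun k hk => h (k + 1) (by simpa using hk)

theorem word_mul {f : IntForm} {m : ℕ} (hm : next^[m] f = f) (k : ℕ) :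
    f.word (k * m) = (List.replicate k (f.word m)).flatten := by
  induction k with
  | zero => simp [word]
  | succ k ih => rw [add_mul, one_mul, add_comm, word_add, hm, ih]; rfl

/-- The word of one turn more than a period can be split after its first letter or before its last
one; the last letter is the first turn of the next round. -/
theorem word_rotate {f : IntForm} {m : ℕ} (hm : next^[m] f = f) :
    f.next.word m = (f.word m).rotate 1 := by
  cases m with
  | zero => rfl
  | succ m =>
    have h := word_add f (m + 1) 1
    rw [hm, word_succ] at h
    have e : f.word 1 = [f.turn] := rfl
    rw [e, word_succ f m, List.cons_append, List.cons.injEq] at h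
    rw [word_succ f m, List.rotate_cons_succ, List.rotate_zero]
    exact h.2

/-- `w` is the sequence of turns along the river until `f` occurs again for the first time. -/
def IsRiverSequence (f : IntForm) (w : List Bool) : Prop :=
  w ≠ [] ∧ (∀ k ≤ w.length, (f.act (w.take k)).Simple) ∧ f.act w = f ∧
    ∀ k, 0 < k → k < w.length → f.act (w.take k) ≠ f

/-- The sequence of turns along the river until `f` occurs again for the first time. -/
noncomputable def riverWord (f : IntForm) : List Bool := f.word (minimalPeriod next f)

theorem River.isRiverSequence {f : IntForm} (hf : f.River) : f.IsRiverSequence f.riverWord := by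
  have hp := minimalPeriod_pos_of_mem_periodicPts hf.mem_periodicPts
  refine ⟨fun h => ?_, fun k hk => ?_, ?_, fun k hk hk' h => ?_⟩
  · have := congrArg List.length h
    simp only [riverWord, length_word, List.length_nil] at this
    omega
  · rw [riverWord, length_word] at hk
    rw [riverWord, take_word f hk, act_word]
    exact (hf.iterate k).1
  · rw [riverWord, act_word, iterate_minimalPeriod]
  · rw [riverWord, length_word] at hk'
    rw [riverWord, take_word f hk'.le, act_word] at h
    exact not_isPeriodicPt_of_pos_of_lt_minimalPeriod hk.ne' hk' h

theorem River.eq_riverWord {f : IntForm} (hf : f.River) {w : List Bool}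
    (hw : f.IsRiverSequence w) : w = f.riverWord := by
  obtain ⟨h0, h1, h2, h3⟩ := hw
  have e := eq_word h1
  have hpos : 0 < w.length := List.length_pos_iff.2 h0
  have hper : IsPeriodicPt IntForm.next w.length f := by
    rw [e, act_word] at h2; exact h2
  have hle := hper.minimalPeriod_le hpos
  rcases hle.lt_or_eq with hlt | heq
  · exfalso
    refine h3 _ (minimalPeriod_pos_of_mem_periodicPts hf.mem_periodicPts) hlt ?_
    rw [e, take_word f hle, act_word, iterate_minimalPeriod]
  · rw [riverWord, heq]; exact e

theorem River.riverWord_iterate {f : IntForm} (hf : f.River) (k : ℕ) :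
    (IntForm.next^[k] f).riverWord = f.riverWord.rotate k := by
  induction k with
  | zero => simp
  | succ k ih =>
    rw [iterate_succ_apply', ← List.rotate_rotate, ← ih, riverWord, riverWord,
      minimalPeriod_apply (hf.iterate k).mem_periodicPts, word_rotate iterate_minimalPeriod]

/-- The coefficients of the form are all positive or all negative. -/
def SameSigns (f : IntForm) : Prop :=
  (0 < f.1 ∧ 0 < f.2.1 ∧ 0 < f.2.2) ∨ (f.1 < 0 ∧ f.2.1 < 0 ∧ f.2.2 < 0)

/-- After a turn the coefficients are sums of the old ones with nonnegative multiplicities. -/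
theorem SameSigns.act {f : IntForm} (hf : f.SameSigns) (w : List Bool) :
    (f.act w).SameSigns := by
  induction w generalizing f with
  | nil => exact hf
  | cons x w ih =>
    refine ih ?_
    cases x <;> simp only [SameSigns, step] at hf ⊢ <;> omega

/-- Outside the river, the labels climb or descend without end. -/
theorem River.act_eq {f : IntForm} (hf : f.River) (w : List Bool) :
    f.act w = IntForm.next^[w.length] f ∨ (f.act w).SameSigns := by
  induction w generalizing f with
  | nil => exact .inl rfl
  | cons x w ih =>
    by_cases hx : x = f.turn
    · subst hx
      exact ih hf.next
    · refine .inr (SameSigns.act ?_ w)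
      -- The wrong turn: if `a + b + c > 0`, a left turn gives the middle coefficient `2a + b > a -
      -- c > 0`, so all three are positive. If `a + b + c < 0`, a right turn gives `b + 2c < c - a <
      -- 0`, so all three are negative.
      have h0 := sum_ne_zero hf.2
      obtain ⟨h1, h2⟩ := hf.1
      cases x
      · have : f.turn = true := by simpa using hx
        rw [turn_eq_true] at this
        simp only [SameSigns, step]; omega
      · have : f.turn = false := by simpa using hx
        rw [turn_eq_false hf.2] at this
        simp only [SameSigns, step]; omega

/-! ### Matrices of words and the forms that they fix. -/

/-- The form obtained by a linear substitution of the variables. -/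
def subst (f : IntForm) (M : Matrix (Fin 2) (Fin 2) ℤ) : IntForm :=
  (f.1 * M 0 0 ^ 2 + f.2.1 * M 0 0 * M 1 0 + f.2.2 * M 1 0 ^ 2,
    2 * f.1 * M 0 0 * M 0 1 + f.2.1 * (M 0 0 * M 1 1 + M 0 1 * M 1 0) + 2 * f.2.2 * M 1 0 * M 1 1,
    f.1 * M 0 1 ^ 2 + f.2.1 * M 0 1 * M 1 1 + f.2.2 * M 1 1 ^ 2)

/-- The substitution belonging to a turn. -/
def turnMatrix : Bool → Matrix (Fin 2) (Fin 2) ℤ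
  | false => !![1, 1; 0, 1]
  | true => !![1, 0; 1, 1]

/-- The substitution belonging to a sequence of turns. -/
def wordMatrix (w : List Bool) : Matrix (Fin 2) (Fin 2) ℤ := (w.map turnMatrix).prod

@[simp] theorem wordMatrix_nil : wordMatrix [] = 1 := rfl

@[simp] theorem wordMatrix_cons (x : Bool) (w : List Bool) :
    wordMatrix (x :: w) = turnMatrix x * wordMatrix w := by
  simp [wordMatrix]

theorem wordMatrix_append (u v : List Bool) :
    wordMatrix (u ++ v) = wordMatrix u * wordMatrix v := by
  simp [wordMatrix]

theorem wordMatrix_replicate (k : ℕ) (u : List Bool) :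
    wordMatrix (List.replicate k u).flatten = wordMatrix u ^ k := by
  induction k with
  | zero => simp
  | succ k ih => rw [List.replicate_succ, List.flatten_cons, wordMatrix_append, ih, pow_succ']

theorem det_wordMatrix (w : List Bool) : (wordMatrix w).det = 1 := by
  induction w with
  | nil => simp
  | cons x w ih =>
    rw [wordMatrix_cons, Matrix.det_mul, ih]
    cases x <;> simp [turnMatrix, Matrix.det_fin_two]

theorem subst_mul (f : IntForm) (M N : Matrix (Fin 2) (Fin 2) ℤ) :
    f.subst (M * N) = (f.subst M).subst N := by
  simp only [subst, Matrix.mul_apply, Fin.sum_univ_two, Prod.mk.injEq]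
  refine ⟨?_, ?_, ?_⟩ <;> ring

theorem act_eq_subst (f : IntForm) (w : List Bool) : f.act w = f.subst (wordMatrix w) := by
  induction w generalizing f with
  | nil => simp [subst]
  | cons x w ih =>
    rw [act_cons, ih, wordMatrix_cons, subst_mul]
    congr 1
    cases x <;> simp [step, subst, turnMatrix]

theorem act_smul (n : ℤ) (f : IntForm) (w : List Bool) : (n • f : IntForm).act w = n • f.act w := by
  simp only [act_eq_subst, subst, Prod.smul_def, smul_eq_mul, Prod.mk.injEq]
  refine ⟨?_, ?_, ?_⟩ <;> ring

/-- A form that is fixed by the substitution `N` if `N` has determinant `1`. -/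
def fixedForm (N : Matrix (Fin 2) (Fin 2) ℤ) : IntForm := (N 1 0, N 1 1 - N 0 0, -N 0 1)

/-- `fixedForm N` is the form `v ↦ det (v, N v)`, and `det (M v, N M v) = det (v, adj(M) N M v)`.
For `det M = 1` the substitution thus conjugates `N`. -/
theorem fixedForm_subst (N M : Matrix (Fin 2) (Fin 2) ℤ) :
    (fixedForm N).subst M = fixedForm (M.adjugate * N * M) := by
  simp only [fixedForm, subst, Matrix.mul_apply, Fin.sum_univ_two, Matrix.adjugate_fin_two,
    Prod.mk.injEq, Matrix.of_apply, Matrix.cons_val', Matrix.cons_val_zero, Matrix.cons_val_one,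
    Matrix.cons_val_fin_one]
  refine ⟨?_, ?_, ?_⟩ <;> ring

theorem fixedForm_subst_of_commute {N M : Matrix (Fin 2) (Fin 2) ℤ} (h : Commute N M)
    (hM : M.det = 1) : (fixedForm N).subst M = fixedForm N := by
  rw [fixedForm_subst, mul_assoc, h.eq, ← mul_assoc, Matrix.adjugate_mul, hM, one_smul, one_mul]

/-- Walking along `u` conjugates the matrix of `u ++ v` into that of the rotated word. -/
theorem act_fixedForm_append (u v : List Bool) :
    (fixedForm (wordMatrix (u ++ v))).act u = fixedForm (wordMatrix (v ++ u)) := by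
  rw [act_eq_subst, fixedForm_subst, wordMatrix_append, wordMatrix_append, ← mul_assoc,
    Matrix.adjugate_mul, det_wordMatrix, one_smul, one_mul]

theorem disc_fixedForm {N : Matrix (Fin 2) (Fin 2) ℤ} (hN : N.det = 1) :
    (fixedForm N).disc = (N 0 0 + N 1 1) ^ 2 - 4 := by
  rw [Matrix.det_fin_two] at hN
  simp only [fixedForm, disc]
  linear_combination -4 * hN

/-- The forms fixed by a substitution are proportional. -/
theorem smul_eq_smul_fixedForm {f : IntForm} {N : Matrix (Fin 2) (Fin 2) ℤ} (hN : N.det = 1)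
    (h : f.subst N = f) : N 1 0 • f = f.1 • fixedForm N := by
  rw [Matrix.det_fin_two] at hN
  obtain ⟨a, b, c⟩ := f
  simp only [subst, Prod.mk.injEq] at h
  obtain ⟨h1, h2, h3⟩ := h
  simp only [fixedForm, Prod.smul_def, smul_eq_mul, Prod.mk.injEq]
  generalize N 0 0 = p at *
  generalize N 0 1 = q at *
  generalize N 1 0 = r at *
  generalize N 1 1 = s at *
  -- With `F = !![2a, b; b, 2c]`, the hypothesis is `Nᵀ F N = F`. Multiplying on the right by `N⁻¹ =
  -- !![s, -q; -r, p]` gives `Nᵀ F = F N⁻¹`; its first row yields `e1` and `e2`.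
  have e1 : 2 * (r * b) = 2 * (a * (s - p)) := by
    linear_combination 2 * s * h1 - r * h2 - (2 * a * p + b * r) * hN
  have e2 : 2 * (r * c) = 2 * (a * -q) := by
    linear_combination -2 * q * h1 + p * h2 - (b * p + 2 * c * r) * hN
  exact ⟨mul_comm _ _, by linarith, by linarith⟩

theorem wordMatrix_nonneg (w : List Bool) :
    0 < wordMatrix w 0 0 ∧ 0 ≤ wordMatrix w 0 1 ∧ 0 ≤ wordMatrix w 1 0 ∧ 0 < wordMatrix w 1 1 := by
  induction w with
  | nil => simp
  | cons x w ih =>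
    cases x <;> simp [turnMatrix, Matrix.mul_apply, Fin.sum_univ_two] <;> omega

theorem wordMatrix_zero_one_pos {w : List Bool} (h : false ∈ w) : 0 < wordMatrix w 0 1 := by
  induction w with
  | nil => simp at h
  | cons x w ih =>
    have := wordMatrix_nonneg w
    cases x
    · simp [turnMatrix, Matrix.mul_apply, Fin.sum_univ_two]; omega
    · have := ih (by simpa using h)
      simpa [turnMatrix, Matrix.mul_apply, Fin.sum_univ_two]

theorem wordMatrix_one_zero_pos {w : List Bool} (h : true ∈ w) : 0 < wordMatrix w 1 0 := by
  induction w with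
  | nil => simp at h
  | cons x w ih =>
    have := wordMatrix_nonneg w
    cases x
    · have := ih (by simpa using h)
      simpa [turnMatrix, Matrix.mul_apply, Fin.sum_univ_two]
    · simp [turnMatrix, Matrix.mul_apply, Fin.sum_univ_two]; omega

/-- A closed path with nonempty sequence of turns on the river takes left and right turns. -/
theorem Simple.one_zero_pos {f : IntForm} (hf : f.Simple) {w : List Bool} (hw : w ≠ [])
    (h : f.act w = f) : 0 < wordMatrix w 1 0 ∧ 0 < wordMatrix w 0 1 := by
  rw [act_eq_subst] at h
  have e := smul_eq_smul_fixedForm (det_wordMatrix w) h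
  -- Since `f.1` and `f.2.2` have opposite signs, this equation makes one off-diagonal entry vanish
  -- if and only if the other does.
  have e3 : wordMatrix w 1 0 * f.2.2 = f.1 * -wordMatrix w 0 1 := congrArg (fun g => g.2.2) e
  obtain ⟨h1, h2⟩ := hf
  have hn := wordMatrix_nonneg w
  obtain ⟨x, hx⟩ := List.exists_mem_of_ne_nil w hw
  cases x
  · have hq := wordMatrix_zero_one_pos hx
    refine ⟨lt_of_le_of_ne hn.2.2.1 fun h0 => ?_, hq⟩
    rw [← h0] at e3
    nlinarith
  · have hr := wordMatrix_one_zero_pos hx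
    refine ⟨hr, lt_of_le_of_ne hn.2.1 fun h0 => ?_⟩
    rw [← h0] at e3
    nlinarith

theorem smul_left_cancel {n : ℤ} (hn : n ≠ 0) {f g : IntForm} (h : n • f = n • g) : f = g := by
  obtain ⟨a, b, c⟩ := f
  obtain ⟨a', b', c'⟩ := g
  simp only [Prod.smul_def, smul_eq_mul, Prod.mk.injEq] at h ⊢
  exact ⟨mul_left_cancel₀ hn h.1, mul_left_cancel₀ hn h.2.1, mul_left_cancel₀ hn h.2.2⟩

/-- With `m / n` in lowest terms, the denominator divides every coefficient of `f`, hence is a unit.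
-/
theorem dvd_of_smul_eq_smul {m n : ℤ} {f g : IntForm} (hf : f.Primitive) (h : m • f = n • g) :
    n ∣ m := by
  obtain ⟨a, b, c⟩ := f
  obtain ⟨a', b', c'⟩ := g
  simp only [Prod.smul_def, smul_eq_mul, Prod.mk.injEq] at h
  obtain ⟨h1, h2, h3⟩ := h
  -- Here `m • f = 0`, and a primitive form is not zero because `0` is not a unit.
  by_cases hn : n = 0
  · subst hn
    rw [zero_dvd_iff]
    by_contra hm
    simp only [zero_mul, mul_eq_zero, hm, false_or] at h1 h2 h3
    have := hf 0 (by simp [h1]) (by simp [h2]) (by simp [h3])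
    simp at this
  have hg : (Int.gcd n m : ℤ) ≠ 0 := by
    rw [Int.coe_gcd]; intro h0; exact hn (gcd_eq_zero_iff _ _ |>.1 h0).1
  obtain ⟨n', hn'⟩ := Int.gcd_dvd_left n m
  obtain ⟨m', hm'⟩ := Int.gcd_dvd_right n m
  have hcop : IsCoprime n' m' := by
    rw [Int.isCoprime_iff_gcd_eq_one]
    have := Int.gcd_div_gcd_div_gcd (i := n) (j := m) (by positivity)
    rwa [Int.ediv_eq_of_eq_mul_right hg hn', Int.ediv_eq_of_eq_mul_right hg hm'] at this
  generalize (Int.gcd n m : ℤ) = G at hg hn' hm'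
  have key : ∀ x y : ℤ, m * x = n * y → n' ∣ x := by
    intro x y hxy
    rw [hn', hm', mul_assoc, mul_assoc] at hxy
    exact hcop.dvd_of_dvd_mul_left ⟨y, mul_left_cancel₀ hg hxy⟩
  have hu := hf n' (key _ _ h1) (key _ _ h2) (key _ _ h3)
  rw [hn', hm']
  exact mul_dvd_mul_left _ (hu.dvd)

/-- A primitive simple form is determined by a closed path along the river. -/
theorem eq_of_act_eq {f g : IntForm} (hf : f.Simple) (hg : g.Simple) (hf' : f.Primitive)
    (hg' : g.Primitive) {w : List Bool} (hw : w ≠ []) (hfw : f.act w = f) (hgw : g.act w = g) :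
    f = g := by
  have hr := (hf.one_zero_pos hw hfw).1
  rw [act_eq_subst] at hfw hgw
  have e1 := smul_eq_smul_fixedForm (det_wordMatrix w) hfw
  have e2 := smul_eq_smul_fixedForm (det_wordMatrix w) hgw
  -- Both forms are proportional to the fixed form of the same matrix. By primitivity the two
  -- positive leading coefficients then divide each other.
  have e : g.1 • f = f.1 • g := by
    apply smul_left_cancel hr.ne'
    rw [smul_comm, e1, smul_comm (wordMatrix w 1 0) f.1 g, e2, smul_comm]
  have d1 := dvd_of_smul_eq_smul hf' e
  have d2 := dvd_of_smul_eq_smul hg' e.symm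
  rw [Int.dvd_antisymm hf.1.le hg.1.le d1 d2] at e
  exact smul_left_cancel hg.1.ne' e

/-- The river sequence is not made of several identical parts. -/
theorem River.not_isRepeating {f : IntForm} (hf : f.River) :
    ¬ IsRepeating (f.riverWord : Cycle Bool) := by
  rintro ⟨u, k, hk, h⟩
  obtain ⟨j, hj⟩ : f.riverWord ~r (List.replicate k u).flatten := Cycle.coe_eq_coe.1 h
  -- A start further along the river makes the word itself, not only its necklace, a power of `u`.
  rw [← hf.riverWord_iterate] at hj
  have hg := hf.iterate j
  generalize IntForm.next^[j] f = g at hj hg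
  obtain ⟨h0, h1, h2, h3⟩ := hg.isRiverSequence
  have hr := (hg.1.one_zero_pos h0 h2).1
  have hlen : g.riverWord.length = k * u.length := by simp [hj]
  have hpos : 0 < k * u.length := hlen ▸ List.length_pos_iff.2 h0
  have hu : 0 < u.length := Nat.pos_of_mul_pos_left hpos
  refine h3 u.length hu (by rw [hlen]; nlinarith) ?_
  have htake : g.riverWord.take u.length = u := by
    obtain ⟨k, rfl⟩ : ∃ k', k = k' + 1 := ⟨k - 1, by omega⟩
    rw [hj, List.replicate_succ, List.flatten_cons, List.take_left]
  rw [htake]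
  rw [act_eq_subst] at h2
  have e := smul_eq_smul_fixedForm (det_wordMatrix _) h2
  -- It suffices that the matrix of `u` fixes a nonzero multiple of `g`. It fixes `fixedForm` of the
  -- whole matrix, which is one of its own powers.
  apply smul_left_cancel hr.ne'
  rw [← act_smul, e, act_smul, act_eq_subst, fixedForm_subst_of_commute _ (det_wordMatrix u)]
  rw [hj, wordMatrix_replicate]
  exact (Commute.refl _).pow_left k

/-- The matrix of a single letter has a zero off the diagonal, which a closed path on the river
excludes. -/
theorem River.two_le_length {f : IntForm} (hf : f.River) : 2 ≤ f.riverWord.length := by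
  obtain ⟨h0, h1, h2, h3⟩ := hf.isRiverSequence
  have h := hf.1.one_zero_pos h0 h2
  generalize f.riverWord = w at *
  match w, h0, h with
  | [false], _, h => simp [turnMatrix] at h
  | [true], _, h => simp [turnMatrix] at h
  | _ :: _ :: _, _, _ => simp

theorem exists_primitive_smul {f : IntForm} (hf : 0 < f.1) :
    ∃ (n : ℤ) (g : IntForm), 0 < n ∧ f = n • g ∧ g.Primitive := by
  obtain ⟨a, b, c⟩ := f
  have ha : 0 < a := hf
  set n : ℤ := gcd a (gcd b c) with hn
  have hn0 : n ≠ 0 := fun h => ha.ne' ((gcd_eq_zero_iff _ _).1 h).1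
  have hnpos : 0 < n := by
    have : 0 ≤ n := by rw [hn, ← Int.coe_gcd]; positivity
    omega
  obtain ⟨a', ha'⟩ : n ∣ a := gcd_dvd_left _ _
  obtain ⟨b', hb'⟩ : n ∣ b := (gcd_dvd_right _ _).trans (gcd_dvd_left _ _)
  obtain ⟨c', hc'⟩ : n ∣ c := (gcd_dvd_right _ _).trans (gcd_dvd_right _ _)
  refine ⟨n, (a', b', c'), hnpos, by simp [← ha', ← hb', ← hc'], ?_⟩
  intro m h1 h2 h3
  have : n * m ∣ n * 1 := by
    rw [mul_one]
    nth_rw 2 [hn]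
    refine dvd_gcd ?_ (dvd_gcd ?_ ?_)
    · rw [ha']; exact mul_dvd_mul_left _ h1
    · rw [hb']; exact mul_dvd_mul_left _ h2
    · rw [hc']; exact mul_dvd_mul_left _ h3
  exact isUnit_of_dvd_one ((mul_dvd_mul_iff_left hn0).1 this)

/-- A word that avoids one letter is a power of the other letter. -/
theorem mem_of_not_isRepeating {w : List Bool} (h2 : 2 ≤ w.length)
    (h : ¬ IsRepeating (w : Cycle Bool)) (x : Bool) : x ∈ w := by
  by_contra hx
  refine h ⟨[!x], w.length, h2, ?_⟩
  congr 1
  rw [List.flatten_replicate_singleton, List.eq_replicate_iff]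
  refine ⟨rfl, fun y hy => ?_⟩
  cases x <;> cases y <;> simp_all

/-- Every nonrepeating word is the river sequence of a primitive form. -/
theorem exists_riverWord_eq {w : List Bool} (h2 : 2 ≤ w.length)
    (h : ¬ IsRepeating (w : Cycle Bool)) :
    ∃ f : IntForm, f.Primitive ∧ f.River ∧ 0 < f.disc ∧ f.riverWord = w := by
  have hp := mem_of_not_isRepeating h2 h
  have hr := wordMatrix_one_zero_pos (hp true)
  have hq := wordMatrix_zero_one_pos (hp false)
  have hn := wordMatrix_nonneg w
  obtain ⟨n, f, hnpos, hf, hprim⟩ := exists_primitive_smul (f := fixedForm (wordMatrix w)) hr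
  -- Along the path, the form stays proportional to the fixed form of a rotation of `w`. Every
  -- rotation contains both letters, so the outer coefficients keep their signs.
  have hact : ∀ k ≤ w.length, (f.act (w.take k)).Simple := by
    intro k hk
    have e : n • f.act (w.take k) = fixedForm (wordMatrix (w.drop k ++ w.take k)) := by
      rw [← act_smul, ← hf, ← act_fixedForm_append, List.take_append_drop]
    have hp' : ∀ x, x ∈ w.drop k ++ w.take k := fun x => by
      have := hp x
      rw [← List.take_append_drop k w] at this
      simp only [List.mem_append] at this ⊢
      exact this.symm
    have hr' := wordMatrix_one_zero_pos (hp' true)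
    have hq' := wordMatrix_zero_one_pos (hp' false)
    have e1 : n * (f.act (w.take k)).1 = _ := congrArg (fun g => g.1) e
    have e2 : n * (f.act (w.take k)).2.2 = _ := congrArg (fun g => g.2.2) e
    simp only [fixedForm] at e1 e2
    exact ⟨pos_of_mul_pos_right (e1 ▸ hr') hnpos.le, by
      by_contra hc
      have := mul_nonneg hnpos.le (not_lt.1 hc)
      omega⟩
  have hclosed : f.act w = f := by
    apply smul_left_cancel hnpos.ne'
    have := act_fixedForm_append w []
    rw [List.append_nil, List.nil_append] at this
    rw [← act_smul, ← hf, this]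
  have hdisc : n ^ 2 * f.disc = (wordMatrix w 0 0 + wordMatrix w 1 1) ^ 2 - 4 := by
    rw [← disc_fixedForm (det_wordMatrix w), hf]
    simp only [disc, Prod.smul_def, smul_eq_mul]
    ring
  have hsimple : f.Simple := hact 0 (Nat.zero_le _)
  have hpos : 0 < f.disc := by
    have := mul_pos hsimple.1 (neg_pos.2 hsimple.2)
    simp only [disc]
    nlinarith [sq_nonneg f.2.1]
  have hns : ¬ IsSquare f.disc := by
    rintro ⟨m, hm⟩
    -- A smaller trace would force both diagonal entries to be `1`, and the determinant to be less
    -- than `1`. From `3` on, `t² - 4` lies strictly between `(t - 1)²` and `t²`.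
    have ht : 3 ≤ wordMatrix w 0 0 + wordMatrix w 1 1 := by
      have hd := det_wordMatrix w
      rw [Matrix.det_fin_two] at hd
      have := mul_pos hq hr
      by_contra hlt
      have h1 : wordMatrix w 0 0 = 1 := by omega
      have h2 : wordMatrix w 1 1 = 1 := by omega
      rw [h1, h2] at hd
      omega
    rw [hm] at hdisc
    generalize wordMatrix w 0 0 + wordMatrix w 1 1 = t at hdisc ht
    have e : |n * m| ^ 2 = t ^ 2 - 4 := by rw [sq_abs]; linear_combination hdisc
    have hz := abs_nonneg (n * m)
    generalize |n * m| = z at e hz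
    have h1 : z < t := by nlinarith
    have h3 : t - 1 < z := by nlinarith
    omega
  have hriver : f.River := ⟨hsimple, hns⟩
  refine ⟨f, hprim, hriver, hpos, ?_⟩
  have hw := eq_word hact
  have hper : next^[w.length] f = f := by
    rw [hw, act_word] at hclosed; exact hclosed
  -- A form recurring before the end of `w` would make `w` a proper power of the word of the minimal
  -- period.
  obtain ⟨k, hk⟩ := IsPeriodicPt.minimalPeriod_dvd (f := next) hper
  rw [mul_comm] at hk
  rw [hk, word_mul iterate_minimalPeriod] at hw
  have hk2 : ¬ 2 ≤ k := fun hk2 => h ⟨_, k, hk2, by rw [← hw]⟩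
  obtain rfl : k = 1 := by
    rcases k with _ | _ | k
    · rw [Nat.zero_mul] at hk; omega
    · rfl
    · omega
  rw [riverWord]
  simpa using hw.symm

end IntForm

/-! ### Local structure of plane cubic trees. -/

namespace PlaneCubicTree

variable {T : PlaneCubicTree}

@[simp] theorem rev_rev (d : T.G.Dart) : T.rev (T.rev d) = d := SimpleGraph.Dart.symm_symm d

@[simp] theorem rev_fst (d : T.G.Dart) : (T.rev d).fst = d.snd := rfl

@[simp] theorem rev_snd (d : T.G.Dart) : (T.rev d).snd = d.fst := rfl

theorem ncard_setOf_fst_eq (v : T.V) : {d : T.G.Dart | d.fst = v}.ncard = 3 := by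
  rw [← T.degree_three v, ← Set.InjOn.ncard_image (f := fun d : T.G.Dart => d.snd)]
  · congr 1
    ext u
    simp only [Set.mem_image, Set.mem_ofPred_eq, SimpleGraph.mem_neighborSet]
    constructor
    · rintro ⟨d, rfl, rfl⟩
      exact d.adj
    · intro h
      exact ⟨⟨(v, u), h⟩, rfl, rfl⟩
  · intro d hd e he h
    exact SimpleGraph.Dart.ext _ _ (Prod.ext (hd.trans he.symm) h)

/-- The cycle of `rot` through `d` contains all three directed edges at its vertex, so it cannot
have length one; nor length two in `rot_rot_ne`. -/
theorem rot_ne (d : T.G.Dart) : T.rot d ≠ d := by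
  intro h
  have hs : {e : T.G.Dart | e.fst = d.fst} ⊆ {d} := by
    intro e he
    obtain ⟨i, hi⟩ := T.rot_cyclic d e (Eq.symm he)
    rw [Equiv.Perm.zpow_apply_eq_self_of_apply_eq_self h] at hi
    exact hi.symm
  have := Set.ncard_le_ncard hs
  rw [ncard_setOf_fst_eq, Set.ncard_singleton] at this
  omega

theorem rot_rot_ne (d : T.G.Dart) : T.rot (T.rot d) ≠ d := by
  intro h
  have hs : {e : T.G.Dart | e.fst = d.fst} ⊆ {d, T.rot d} := by
    intro e he
    obtain ⟨i, hi⟩ := T.rot_cyclic d e (Eq.symm he)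
    rw [← hi]
    exact Equiv.Perm.zpow_apply_eq_of_apply_apply_eq_self h i
  have := (Set.ncard_le_ncard hs).trans (Set.ncard_insert_le _ _)
  rw [ncard_setOf_fst_eq, Set.ncard_singleton] at this
  omega

/-- The three directed edges out of a vertex. -/
theorem eq_or_of_fst_eq {d e : T.G.Dart} (h : e.fst = d.fst) :
    e = d ∨ e = T.rot d ∨ e = T.rot (T.rot d) := by
  have hs : ({d, T.rot d, T.rot (T.rot d)} : Set T.G.Dart) ⊆ {e | e.fst = d.fst} := by
    rintro x (rfl | rfl | rfl)
    · rfl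
    · exact T.rot_fst _
    · exact (T.rot_fst _).trans (T.rot_fst _)
  have hfin : {e : T.G.Dart | e.fst = d.fst}.Finite :=
    Set.finite_of_ncard_ne_zero (by rw [ncard_setOf_fst_eq]; omega)
  have hcard : ({d, T.rot d, T.rot (T.rot d)} : Set T.G.Dart).ncard = 3 :=
    Set.ncard_eq_three.2 ⟨_, _, _, (rot_ne d).symm, (rot_rot_ne d).symm, (rot_ne _).symm, rfl⟩
  have := Set.eq_of_subset_of_ncard_le hs (by rw [ncard_setOf_fst_eq, hcard]) hfin
  have he : e ∈ {e : T.G.Dart | e.fst = d.fst} := h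
  rw [← this] at he
  simpa using he

@[simp] theorem rot_rot_rot (d : T.G.Dart) : T.rot (T.rot (T.rot d)) = d := by
  have h : (T.rot (T.rot (T.rot d))).fst = d.fst := by simp only [T.rot_fst]
  rcases eq_or_of_fst_eq h with h | h | h
  · exact h
  · exact absurd (T.rot.injective h) (rot_rot_ne d)
  · exact absurd (T.rot.injective (T.rot.injective h)) (rot_ne d)

theorem right_apply (d : T.G.Dart) : T.right d = T.rot (T.rev d) := rfl

theorem left_apply (d : T.G.Dart) : T.left d = T.rot (T.rot (T.rev d)) := by
  change T.rot.symm (T.rev d) = _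
  rw [Equiv.symm_apply_eq, rot_rot_rot]

@[simp] theorem step_fst (d : T.G.Dart) (x : Bool) : (step d x).fst = d.snd := by
  cases x
  · rw [step, left_apply, T.rot_fst, T.rot_fst, rev_fst]
  · rw [step, right_apply, T.rot_fst, rev_fst]

@[simp] theorem follow_nil (d : T.G.Dart) : follow d [] = d := rfl

@[simp] theorem follow_cons (d : T.G.Dart) (x : Bool) (w : List Bool) :
    follow d (x :: w) = follow (step d x) w := rfl

theorem follow_append (d : T.G.Dart) (u v : List Bool) :
    follow d (u ++ v) = follow (follow d u) v := List.foldl_append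

theorem leftRegion_left (d : T.G.Dart) : leftRegion (T.left d) = leftRegion d :=
  Quotient.sound (Equiv.Perm.sameCycle_apply_left.2 (Equiv.Perm.SameCycle.refl _ _))

/-- On the way back a left turn becomes a right turn and conversely. -/
theorem rev_step (d : T.G.Dart) (x : Bool) : T.rev d = step (T.rev (step d x)) (!x) := by
  cases x
  · simp [step, left_apply, right_apply]
  · simp [step, left_apply, right_apply]

/-- A path can be followed back. -/
theorem exists_follow_rev (d : T.G.Dart) (w : List Bool) :
    ∃ u, follow (T.rev (follow d w)) u = T.rev d := by
  induction w generalizing d with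
  | nil => exact ⟨[], rfl⟩
  | cons x w ih =>
    obtain ⟨u, hu⟩ := ih (step d x)
    exact ⟨u ++ [!x], by rw [follow_cons, follow_append, hu, rev_step d x]; rfl⟩

/-! ### The model tree of positions. -/

/-- A position in the tree seen from a directed edge: the direction to start in (`true` for
backwards), and the turns to make, the last one first. -/
abbrev Node : Type := Bool × List Bool

/-- The directed edge that is reached last on the way to a position. -/
def out (d : T.G.Dart) (m : Node) : T.G.Dart :=
  follow (if m.1 then T.rev d else d) m.2.reverse

@[simp] theorem out_cons (d : T.G.Dart) (s x : Bool) (w : List Bool) :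
    out d (s, x :: w) = step (out d (s, w)) x := by
  simp [out, follow_append]

/-- The vertex at a position. -/
def point (d : T.G.Dart) (m : Node) : T.V := (out d m).snd

/-- The position one step back towards the initial edge. -/
def parent : Node → Node
  -- The two ends of the initial edge are each other's parents.
  | (s, []) => (!s, [])
  | (s, _ :: w) => (s, w)

/-- The neighbours of a position. -/
def neighbour (m : Node) : Option Bool → Node
  | none => parent m
  | some x => (m.1, x :: m.2)

/-- The directed edges out of the vertex at a position. -/
def outDart (d : T.G.Dart) (m : Node) : Option Bool → T.G.Dart
  | none => T.rev (out d m)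
  | some x => step (out d m) x

/-- The counterclockwise order of the directions back, right and left. -/
def turnCycle : Equiv.Perm (Option Bool) where
  toFun i := match i with
    | none => some true
    | some true => some false
    | some false => none
  invFun i := match i with
    | none => some false
    | some true => none
    | some false => some true
  left_inv i := by rcases i with _ | _ | _ <;> rfl
  right_inv i := by rcases i with _ | _ | _ <;> rfl

@[simp] theorem outDart_fst (d : T.G.Dart) (m : Node) (i : Option Bool) :
    (outDart d m i).fst = point d m := by
  cases i with
  | none => rfl
  | some x => exact step_fst _ _

@[simp] theorem outDart_snd (d : T.G.Dart) (m : Node) (i : Option Bool) :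
    (outDart d m i).snd = point d (neighbour m i) := by
  obtain ⟨s, w⟩ := m
  cases i with
  | none =>
    cases w with
    | nil => cases s <;> rfl
    | cons x w => simp [outDart, neighbour, parent, point]
  | some x => simp [outDart, neighbour, point]

theorem rot_outDart (d : T.G.Dart) (m : Node) (i : Option Bool) :
    T.rot (outDart d m i) = outDart d m (turnCycle i) := by
  rcases i with _ | _ | _
  · rfl
  · change T.rot (T.left _) = T.rev _
    rw [left_apply, rot_rot_rot]
  · change T.rot (T.right _) = T.left _
    rw [left_apply, right_apply]

theorem outDart_injective (d : T.G.Dart) (m : Node) : Function.Injective (outDart d m) := by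
  have h1 := rot_ne (T.rev (out d m))
  have h2 := rot_rot_ne (T.rev (out d m))
  have h3 := rot_ne (T.rot (T.rev (out d m)))
  intro i j h
  rcases i with _ | _ | _ <;> rcases j with _ | _ | _ <;>
    simp only [outDart, step, left_apply, right_apply] at h <;>
    first
    | rfl
    | exact absurd h h1
    | exact absurd h h2
    | exact absurd h h3
    | exact absurd h.symm h1
    | exact absurd h.symm h2
    | exact absurd h.symm h3

theorem exists_outDart_eq {d e : T.G.Dart} {m : Node} (h : e.fst = point d m) :
    ∃ i, e = outDart d m i := by
  rcases eq_or_of_fst_eq (d := outDart d m none) (h.trans (outDart_fst _ _ _).symm)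
    with h | h | h
  · exact ⟨_, h⟩
  · rw [rot_outDart] at h; exact ⟨_, h⟩
  · rw [rot_outDart, rot_outDart] at h; exact ⟨_, h⟩

/-- Connectedness: the set of vertices with a position is closed under passing to neighbours. -/
theorem point_surjective (d : T.G.Dart) : Function.Surjective (point d) := by
  have key : ∀ {u v : T.V} (_ : T.G.Walk u v), (∃ m, point d m = u) → ∃ m, point d m = v := by
    intro u v p
    induction p with
    | nil => exact id
    | cons h p ih =>
      rintro ⟨m, rfl⟩
      obtain ⟨i, hi⟩ := exists_outDart_eq (d := d) (m := m) (e := ⟨(_, _), h⟩) rfl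
      exact ih ⟨neighbour m i, by rw [← outDart_snd, ← hi]⟩
  intro v
  obtain ⟨p⟩ := T.isTree.connected.preconnected (point d (false, [])) v
  exact key p ⟨_, rfl⟩

theorem exists_outDart (d e : T.G.Dart) : ∃ m i, e = outDart d m i := by
  obtain ⟨m, hm⟩ := point_surjective d e.fst
  exact ⟨m, exists_outDart_eq hm.symm⟩

/-- Every directed edge or its reverse is reached from a given directed edge or its reverse. -/
theorem exists_follow (d e : T.G.Dart) :
    ∃ w, e = follow d w ∨ e = T.rev (follow d w) ∨
      e = follow (T.rev d) w ∨ e = T.rev (follow (T.rev d) w) := by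
  obtain ⟨⟨s, w⟩, i, rfl⟩ := exists_outDart d e
  cases i with
  | none =>
    refine ⟨w.reverse, ?_⟩
    cases s <;> simp [outDart, out]
  | some x =>
    refine ⟨w.reverse ++ [x], ?_⟩
    cases s <;> simp [outDart, out, follow_append]

theorem parent_ne (m : Node) : parent m ≠ m := by
  obtain ⟨s, _ | ⟨x, w⟩⟩ := m <;> simp [parent]

/-- The graph of positions. -/
def nodeGraph : SimpleGraph Node where
  Adj m n := n = parent m ∨ m = parent n
  symm := ⟨fun _ _ h => h.symm⟩
  loopless := ⟨fun m h => parent_ne m (h.elim Eq.symm Eq.symm)⟩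

theorem nodeGraph_adj {m n : Node} : nodeGraph.Adj m n ↔ ∃ i, n = neighbour m i := by
  constructor
  · rintro (rfl | rfl)
    · exact ⟨none, rfl⟩
    · obtain ⟨s, _ | ⟨x, w⟩⟩ := n
      · exact ⟨none, by simp [neighbour, parent]⟩
      · exact ⟨some x, rfl⟩
  · rintro ⟨_ | x, rfl⟩
    · exact .inl rfl
    · exact .inr rfl

theorem neighbour_injective (m : Node) : Function.Injective (neighbour m) := by
  obtain ⟨s, w⟩ := m
  intro i j h
  have hne : ∀ (w : List Bool) x, parent (s, w) ≠ (s, x :: w) := by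
    intro w x h
    cases w with
    | nil => simp [parent] at h
    | cons y w =>
      have := congrArg (fun m : Node => m.2.length) h
      simp [parent] at this
      omega
  rcases i with _ | x <;> rcases j with _ | y
  · rfl
  · exact absurd h (hne _ _)
  · exact absurd h.symm (hne _ _)
  · simpa [neighbour] using h

theorem nodeGraph_isTree : nodeGraph.IsTree := by
  refine ⟨⟨?_⟩, ?_⟩
  · have key : ∀ w s, nodeGraph.Reachable (s, w) (false, []) := by
      intro w
      induction w with
      | nil =>
        rintro (_ | _)
        · exact .refl _
        · exact SimpleGraph.Adj.reachable (Or.inl rfl)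
      | cons x w ih =>
        intro s
        exact (SimpleGraph.Adj.reachable (Or.inl rfl)).trans (ih s)
    exact fun m n => (key m.2 m.1).trans (key n.2 n.1).symm
  · rw [SimpleGraph.isAcyclic_iff_forall_adj_isBridge]
    have key : ∀ m, nodeGraph.IsBridge s(m, parent m) := by
      intro m
      rw [SimpleGraph.isBridge_iff]
      rintro ⟨p⟩
      -- Turns are listed last one first, so a node lies at `m` or beyond it when it has the same
      -- start and `m.2` is a suffix of its turns. Only the edge from `m` to its parent enters or
      -- leaves this set, so that edge is a bridge.
      have hpar : ∀ n, s(n, parent n) ≠ s(m, parent m) →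
          ((n.1 = m.1 ∧ m.2 <:+ n.2) ↔ ((parent n).1 = m.1 ∧ m.2 <:+ (parent n).2)) := by
        rintro ⟨s, _ | ⟨x, w⟩⟩ hn
        · obtain ⟨t, u⟩ := m
          simp only [parent, List.suffix_nil]
          constructor
          · rintro ⟨rfl, rfl⟩
            exact absurd rfl hn
          · rintro ⟨rfl, rfl⟩
            exact absurd (by simp [parent, Sym2.eq_swap]) hn
        · obtain ⟨t, u⟩ := m
          simp only [parent, List.suffix_cons_iff]
          refine and_congr_right ?_
          rintro rfl
          refine ⟨fun h => h.resolve_left ?_, .inr⟩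
          rintro rfl
          exact hn rfl
      have hinv : ∀ {u v : Node} (_ : (nodeGraph.deleteEdges {s(m, parent m)}).Walk u v),
          (u.1 = m.1 ∧ m.2 <:+ u.2) → (v.1 = m.1 ∧ m.2 <:+ v.2) := by
        intro u v p
        induction p with
        | nil => exact id
        | cons h p ih =>
          intro hu
          rw [SimpleGraph.deleteEdges_adj, Set.mem_singleton_iff] at h
          obtain ⟨rfl | rfl, h⟩ := h
          · exact ih ((hpar _ h).1 hu)
          · rw [Sym2.eq_swap] at h
            exact ih ((hpar _ h).2 hu)
      have := hinv p ⟨rfl, List.suffix_refl _⟩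
      obtain ⟨s, _ | ⟨x, w⟩⟩ := m
      · simp [parent] at this
      · have := this.2.length_le
        simp [parent] at this
    rintro m n (rfl | rfl)
    · exact key m
    · rw [Sym2.eq_swap]; exact key n

end PlaneCubicTree

/-- A locally injective homomorphism from a connected graph to a forest is injective. -/
theorem SimpleGraph.IsAcyclic.injective_of_locally_injective {V W : Type*} {G : SimpleGraph V}
    {H : SimpleGraph W} (hH : H.IsAcyclic) (hG : G.Preconnected) (φ : G →g H)
    (hφ : ∀ u v w, G.Adj u v → G.Adj u w → φ v = φ w → v = w) : Function.Injective φ := by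
  intro u v huv
  obtain ⟨p, hp⟩ := (hG u v).exists_isPath
  -- Local injectivity prevents the image of a path from backtracking. In a forest a walk without
  -- backtracking is a path, and a path with equal ends is trivial.
  have key : ∀ {u v : V} (p : G.Walk u v), p.IsPath → (p.map φ).edges.IsChain (· ≠ ·) := by
    intro u v p
    induction p with
    | nil => intro _; simp
    | @cons a b c h p ih =>
      intro hp
      rw [SimpleGraph.Walk.cons_isPath_iff] at hp
      have := ih hp.1
      cases p with
      | nil => simp
      | @cons _ b' _ h' q =>
        simp only [SimpleGraph.Walk.map_cons, SimpleGraph.Walk.edges_cons] at this ⊢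
        refine List.IsChain.cons_cons ?_ this
        intro he
        rw [Sym2.eq_swap, Sym2.congr_right] at he
        have := hφ _ _ _ h.symm h' he
        subst this
        simp at hp
  have h := (hH.isPath_iff_isChain _).2 (key p hp)
  have hnil : ∀ {u v : W} (q : H.Walk u v), u = v → q.IsPath → q.length = 0 := by
    rintro u v q rfl hq
    exact (SimpleGraph.Walk.isPath_iff_nil.1 hq).length_eq_zero
  have h0 := hnil _ huv h
  rw [SimpleGraph.Walk.length_map] at h0
  exact SimpleGraph.Walk.eq_of_length_eq_zero h0

namespace PlaneCubicTree

variable {T : PlaneCubicTree}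

/-- The directed edges of the graph of positions. -/
noncomputable def nodeDart : Node × Option Bool ≃ nodeGraph.Dart :=
  Equiv.ofBijective (fun p => ⟨(p.1, neighbour p.1 p.2), nodeGraph_adj.2 ⟨_, rfl⟩⟩) <| by
    constructor
    · rintro ⟨m, i⟩ ⟨n, j⟩ h
      have h1 : m = n := congrArg (fun d : nodeGraph.Dart => d.fst) h
      subst h1
      exact congrArg (Prod.mk m)
        (neighbour_injective m (congrArg (fun d : nodeGraph.Dart => d.snd) h))
    · rintro ⟨⟨m, n⟩, h⟩
      obtain ⟨i, hi⟩ := nodeGraph_adj.1 h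
      refine ⟨(m, i), ?_⟩
      exact SimpleGraph.Dart.ext _ _ (congrArg (Prod.mk m) hi.symm)

@[simp] theorem nodeDart_fst (p : Node × Option Bool) : (nodeDart p).fst = p.1 := rfl

/-- The plane cubic tree of positions. -/
noncomputable def nodeTree : PlaneCubicTree where
  V := Node
  G := nodeGraph
  isTree := nodeGraph_isTree
  degree_three m := by
    have : nodeGraph.neighborSet m = Set.range (neighbour m) := by
      ext n
      rw [SimpleGraph.mem_neighborSet, nodeGraph_adj]
      simp [eq_comm]
    rw [this, ← Set.image_univ, Set.InjOn.ncard_image (neighbour_injective m).injOn,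
      Set.ncard_univ]
    simp
  rot := nodeDart.permCongr (Equiv.prodCongr (Equiv.refl _) turnCycle)
  rot_fst d := by
    obtain ⟨p, rfl⟩ := nodeDart.surjective d
    simp [Equiv.permCongr_apply]
  rot_cyclic d d' h := by
    obtain ⟨⟨m, i⟩, rfl⟩ := nodeDart.surjective d
    obtain ⟨⟨n, j⟩, rfl⟩ := nodeDart.surjective d'
    obtain rfl : m = n := h
    have hi : ∃ k : ℕ, (turnCycle ^ k) i = j := by
      have : ∀ i j : Option Bool, ∃ k < 3, (turnCycle ^ k) i = j := by decide
      obtain ⟨k, -, hk⟩ := this i j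
      exact ⟨k, hk⟩
    obtain ⟨k, rfl⟩ := hi
    refine ⟨k, ?_⟩
    rw [zpow_natCast]
    induction k with
    | zero => rfl
    | succ k ih =>
      rw [pow_succ', Equiv.Perm.mul_apply, ih, pow_succ', Equiv.Perm.mul_apply]
      simp [Equiv.permCongr_apply]

/-- The directed edges of the tree of positions. -/
noncomputable def treeDart : Node × Option Bool ≃ nodeTree.G.Dart := nodeDart

theorem nodeTree_rot (m : Node) (i : Option Bool) :
    nodeTree.rot (treeDart (m, i)) = treeDart (m, turnCycle i) := by
  change nodeDart (Equiv.prodCongr (Equiv.refl _) turnCycle (nodeDart.symm (nodeDart (m, i)))) =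
    nodeDart (m, turnCycle i)
  rw [Equiv.symm_apply_apply]
  rfl

theorem nodeTree_rev_none_nil (s : Bool) :
    nodeTree.rev (treeDart ((s, []), none)) = treeDart ((!s, []), none) := by
  exact SimpleGraph.Dart.ext _ _ (Prod.ext rfl (by cases s <;> rfl))

theorem nodeTree_rev_none_cons (s x : Bool) (w : List Bool) :
    nodeTree.rev (treeDart ((s, x :: w), none)) = treeDart ((s, w), some x) := by
  exact SimpleGraph.Dart.ext _ _ rfl

theorem nodeTree_rev_some (s x : Bool) (w : List Bool) :
    nodeTree.rev (treeDart ((s, w), some x)) = treeDart ((s, x :: w), none) := by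
  rw [← nodeTree_rev_none_cons, rev_rev]

/-- The tree of positions is isomorphic to every plane cubic tree. -/
theorem exists_iso (d : T.G.Dart) : ∃ φ : nodeTree.G ≃g T.G,
    ∀ m i, φ.toHom.mapDart (treeDart (m, i)) = outDart d m i := by
  have hadj : ∀ m n, nodeGraph.Adj m n → T.G.Adj (point d m) (point d n) := by
    intro m n h
    obtain ⟨i, rfl⟩ := nodeGraph_adj.1 h
    rw [← outDart_snd, ← outDart_fst d m i]
    exact (outDart d m i).adj
  have hloc : ∀ m i j, point d (neighbour m i) = point d (neighbour m j) → i = j := by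
    intro m i j h
    apply outDart_injective d m
    apply SimpleGraph.Dart.ext
    exact Prod.ext (by simp) (by simpa using h)
  -- The map from positions to vertices is injective around each position and the target has no
  -- cycles, so two positions never share a vertex.
  have hinj : Function.Injective (point d) := by
    refine T.isTree.isAcyclic.injective_of_locally_injective
      nodeGraph_isTree.connected.preconnected (⟨point d, fun h => hadj _ _ h⟩ :
        nodeGraph →g T.G) ?_
    intro m n n' h h' e
    obtain ⟨i, rfl⟩ := nodeGraph_adj.1 h
    obtain ⟨j, rfl⟩ := nodeGraph_adj.1 h'
    rw [hloc m i j e]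
  refine ⟨⟨Equiv.ofBijective (point d) ⟨hinj, point_surjective d⟩, fun {m n} => ⟨fun h => ?_,
    fun h => hadj _ _ h⟩⟩, fun m i => ?_⟩
  · obtain ⟨i, hi⟩ := exists_outDart_eq (d := d) (m := m) (e := ⟨(_, _), h⟩) rfl
    have := (congrArg (fun e : T.G.Dart => e.snd) hi).trans (outDart_snd d m i)
    exact nodeGraph_adj.2 ⟨i, hinj this⟩
  · apply SimpleGraph.Dart.ext
    exact Prod.ext (outDart_fst _ _ _).symm (outDart_snd _ _ _).symm

end PlaneCubicTree

/-! ### Topographs correspond to forms at a directed edge. -/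

namespace Topograph

open PlaneCubicTree

variable {T : Topograph}

/-- By the rule, the labels ahead and behind differ from the sum of the side labels by opposite
amounts, so reversal negates the edge label. -/
theorem config_rev (d : T.tree.G.Dart) : T.config (T.tree.rev d) = IntForm.swap (T.config d) := by
  have h := T.rule d
  simp only [config, IntForm.swap, edgeLabel, rightRegion, rev_rev, behindRegion] at h ⊢
  congr 2
  linarith

/-- After a left turn the left region is unchanged, the region ahead has become the right one, and
the former right region lies behind; the rule at the new edge gives its edge label. The right turn
is the mirror image. -/
theorem config_left (d : T.tree.G.Dart) :
    T.config (T.tree.left d) = IntForm.step (T.config d) false := by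
  have h := T.rule (T.tree.left d)
  have h1 : T.tree.right (T.tree.rev (T.tree.left d)) = T.tree.rev d := (rev_step d false).symm
  have h2 : leftRegion (T.tree.rev (T.tree.left d)) = aheadRegion d := by
    rw [← leftRegion_left, aheadRegion]
    congr 1
    simp [left_apply, right_apply]
  simp only [behindRegion, aheadRegion, rightRegion, h1, leftRegion_left] at h h2
  simp only [config, IntForm.step, edgeLabel, rightRegion, aheadRegion, leftRegion_left, h2] at h ⊢
  refine Prod.ext rfl (Prod.ext ?_ ?_) <;> simp only <;> linarith

theorem config_right (d : T.tree.G.Dart) :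
    T.config (T.tree.right d) = IntForm.step (T.config d) true := by
  have h := T.rule (T.tree.right d)
  have h2 : leftRegion (T.tree.rev (T.tree.right d)) = rightRegion d := by
    rw [rightRegion, ← leftRegion_left (T.tree.rev (T.tree.right d))]
    congr 1
    simp [left_apply, right_apply]
  have h3 : leftRegion (T.tree.right (T.tree.rev (T.tree.right d))) = leftRegion d := by
    rw [← leftRegion_left d]
    congr 1
    simp [left_apply, right_apply]
  simp only [behindRegion, aheadRegion, rightRegion, h3] at h h2
  simp only [config, IntForm.step, edgeLabel, rightRegion, aheadRegion, h2] at h ⊢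
  refine Prod.ext ?_ (Prod.ext ?_ rfl) <;> simp only <;> linarith

theorem config_step (d : T.tree.G.Dart) (x : Bool) :
    T.config (step d x) = IntForm.step (T.config d) x := by
  cases x
  · exact config_left d
  · exact config_right d

theorem config_follow (d : T.tree.G.Dart) (w : List Bool) :
    T.config (follow d w) = IntForm.act (T.config d) w := by
  induction w generalizing d with
  | nil => rfl
  | cons x w ih => rw [follow_cons, ih, config_step, IntForm.act_cons]

/-- The form at a position, if `f` is the form at the initial edge. -/
def nodeForm (f : IntForm) (m : Node) : IntForm :=
  (if m.1 then f.swap else f).act m.2.reverse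

/-- The label of the region on the left of a directed edge out of a position. -/
def nodeLabel (f : IntForm) (m : Node) : Option Bool → ℤ
  | none => (nodeForm f m).2.2
  | some x => ((nodeForm f m).step x).1

theorem nodeForm_cons (f : IntForm) (s x : Bool) (w : List Bool) :
    nodeForm f (s, x :: w) = (nodeForm f (s, w)).step x := by
  simp [nodeForm, IntForm.act_append]

theorem nodeForm_not (f : IntForm) (s : Bool) :
    nodeForm f (!s, []) = (nodeForm f (s, [])).swap := by
  cases s <;> simp [nodeForm]

theorem config_out (d : T.tree.G.Dart) (m : Node) :
    T.config (out d m) = nodeForm (T.config d) m := by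
  obtain ⟨s, w⟩ := m
  rw [out, config_follow, nodeForm]
  cases s
  · rfl
  · simp [config_rev]

theorem label_outDart (d : T.tree.G.Dart) (m : Node) (i : Option Bool) :
    T.label (leftRegion (outDart d m i)) = nodeLabel (T.config d) m i := by
  cases i with
  | none => rw [nodeLabel, ← config_out]; rfl
  | some x => rw [nodeLabel, ← config_out, ← config_step]; rfl

/-- The label of the region on the left of a directed edge of the tree of positions. -/
noncomputable def dartLabel (f : IntForm) (d : nodeTree.G.Dart) : ℤ :=
  nodeLabel f (treeDart.symm d).1 (treeDart.symm d).2

@[simp] theorem dartLabel_nodeDart (f : IntForm) (m : Node) (i : Option Bool) :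
    dartLabel f (treeDart (m, i)) = nodeLabel f m i := by
  simp [dartLabel]

/-- Regions are orbits of `left`, so this invariance makes the labels well defined on regions. -/
theorem dartLabel_left (f : IntForm) (d : nodeTree.G.Dart) :
    dartLabel f (nodeTree.left d) = dartLabel f d := by
  obtain ⟨⟨⟨s, w⟩, i⟩, rfl⟩ := treeDart.surjective d
  rw [left_apply]
  rcases i with _ | x
  · rcases w with _ | ⟨_ | _, w⟩
    · rw [nodeTree_rev_none_nil, nodeTree_rot, nodeTree_rot, dartLabel_nodeDart,
        dartLabel_nodeDart]
      change ((nodeForm f (!s, [])).step false).1 = _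
      rw [nodeForm_not]
      rfl
    all_goals
      rw [nodeTree_rev_none_cons, nodeTree_rot, nodeTree_rot, dartLabel_nodeDart,
        dartLabel_nodeDart, nodeLabel, nodeForm_cons]
      rfl
  · rw [nodeTree_rev_some, nodeTree_rot, nodeTree_rot, dartLabel_nodeDart, dartLabel_nodeDart]
    change ((nodeForm f (s, x :: w)).step false).1 = _
    rw [nodeForm_cons]
    rfl

theorem dartLabel_eq_of_sameCycle (f : IntForm) (d e : nodeTree.G.Dart)
    (h : nodeTree.left.SameCycle d e) : dartLabel f d = dartLabel f e := by
  obtain ⟨k, rfl⟩ := h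
  induction k with
  | zero => rfl
  | succ k ih =>
    rw [add_comm, zpow_add, Equiv.Perm.mul_apply, zpow_one, dartLabel_left, ih]
  | pred k ih =>
    rw [ih, ← dartLabel_left f ((nodeTree.left ^ (-(k : ℤ) - 1)) d), ← Equiv.Perm.mul_apply,
      ← zpow_one_add]
    congr 3
    ring

/-- The topograph of a form on the tree of positions. -/
noncomputable def ofForm (f : IntForm) : Topograph where
  tree := nodeTree
  label := Quotient.lift (dartLabel f) (dartLabel_eq_of_sameCycle f)
  rule d := by
    change dartLabel f (nodeTree.right (nodeTree.rev d)) + dartLabel f (nodeTree.right d) =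
      2 * (dartLabel f d + dartLabel f (nodeTree.rev d))
    obtain ⟨⟨⟨s, w⟩, i⟩, rfl⟩ := treeDart.surjective d
    simp only [right_apply, rev_rev]
    have key : ∀ s x w,
        nodeLabel f (s, w) (turnCycle (some x)) + nodeLabel f (s, x :: w) (some true) =
          2 * (nodeLabel f (s, w) (some x) + nodeLabel f (s, x :: w) none) := by
      intro s x w
      cases x <;> simp only [nodeLabel, turnCycle, Equiv.coe_fn_mk, nodeForm_cons, IntForm.step] <;>
        ring
    rcases i with _ | x
    · rcases w with _ | ⟨x, w⟩
      · rw [nodeTree_rev_none_nil, nodeTree_rot, nodeTree_rot]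
        simp only [dartLabel_nodeDart]
        change ((nodeForm f (s, [])).step true).1 + ((nodeForm f (!s, [])).step true).1 =
          2 * ((nodeForm f (s, [])).2.2 + (nodeForm f (!s, [])).2.2)
        rw [nodeForm_not]
        simp only [IntForm.step, IntForm.swap]
        ring
      · rw [nodeTree_rev_none_cons, nodeTree_rot, nodeTree_rot]
        simp only [dartLabel_nodeDart]
        rw [add_comm, add_comm (nodeLabel f (s, x :: w) none)]
        exact key s x w
    · rw [nodeTree_rev_some, nodeTree_rot, nodeTree_rot]
      simp only [dartLabel_nodeDart]
      exact key s x w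

/-- The initial directed edge of the topograph of a form. -/
noncomputable def ofFormDart (f : IntForm) : (ofForm f).tree.G.Dart :=
  -- The position `(true, [])` is reached along the reversed initial edge, so going back from it is
  -- the initial edge itself.
  treeDart ((true, []), none)

theorem config_ofFormDart (f : IntForm) : (ofForm f).config (ofFormDart f) = f := by
  have h1 : (ofForm f).label (leftRegion (ofFormDart f)) = f.1 :=
    dartLabel_nodeDart f (true, []) none
  have e : (ofForm f).tree.rev (ofFormDart f) = treeDart ((false, []), none) :=
    nodeTree_rev_none_nil true
  have h2 : (ofForm f).label (rightRegion (ofFormDart f)) = f.2.2 := by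
    rw [rightRegion, e]
    exact dartLabel_nodeDart f (false, []) none
  have h3 : (ofForm f).label (aheadRegion (ofFormDart f)) = f.1 + f.2.1 + f.2.2 := by
    rw [aheadRegion, right_apply, e]
    change dartLabel f (nodeTree.rot _) = _
    rw [nodeTree_rot]
    exact dartLabel_nodeDart f (false, []) (some true)
  rw [config, edgeLabel, h1, h2, h3]
  refine Prod.ext rfl (Prod.ext ?_ rfl)
  simp only
  ring

/-- A topograph is determined by the form at any of its directed edges. -/
theorem ofForm_same (d : T.tree.G.Dart) : (ofForm (T.config d)).Same T := by
  obtain ⟨φ, hφ⟩ := exists_iso d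
  refine ⟨φ, fun e => ?_, fun e => ?_⟩
  · obtain ⟨⟨m, i⟩, rfl⟩ := treeDart.surjective e
    change φ.toHom.mapDart (nodeTree.rot (treeDart (m, i))) = _
    rw [nodeTree_rot]
    refine (hφ _ _).trans ?_
    rw [← rot_outDart]
    exact congrArg _ (hφ _ _).symm
  · obtain ⟨⟨m, i⟩, rfl⟩ := treeDart.surjective e
    refine Eq.trans ?_ (dartLabel_nodeDart (T.config d) m i).symm
    rw [← label_outDart]
    exact congrArg (fun d => T.label (leftRegion d)) (hφ m i)

theorem same_of_config_eq {T T' : Topograph} (d : T.tree.G.Dart) (d' : T'.tree.G.Dart)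
    (h : T.config d = T'.config d') : T.Same T' :=
  (ofForm_same d).symm.trans (h ▸ ofForm_same d')

end Topograph

/-! ### Descent to the river, and forms met when walking backwards. -/

namespace IntForm

theorem Primitive.act {f : IntForm} (hf : f.Primitive) (w : List Bool) :
    (f.act w).Primitive := by
  induction w generalizing f with
  | nil => exact hf
  | cons x w ih =>
    refine ih fun n h1 h2 h3 => ?_
    obtain ⟨a, b, c⟩ := f
    cases x
    · simp only [step] at h1 h2 h3
      have hb := (Int.dvd_add_right (h1.mul_left 2)).1 h2
      exact hf n h1 hb ((Int.dvd_add_right (h1.add hb)).1 h3)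
    · simp only [step] at h1 h2 h3
      have hb := (Int.dvd_add_left (h3.mul_left 2)).1 h2
      exact hf n ((Int.dvd_add_left hb).1 ((Int.dvd_add_left h3).1 h1)) hb h3

theorem Primitive.swap {f : IntForm} (hf : f.Primitive) : f.swap.Primitive :=
  fun n h1 h2 h3 => hf n h3 ((Int.dvd_neg).1 h2) h1

/-- If `-b ≤ a` and `-b ≤ c`, then `b² ≤ a c < 4 a c`. Otherwise the label ahead, `a + b + c`, is
smaller than one of `a`, `c`, and a suitable turn replaces that one. -/
theorem disc_pos_or {a b c : ℤ} (ha : 0 < a) (hc : 0 < c) (hD : 0 < b ^ 2 - 4 * a * c) (hb : b < 0) :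
    a + b < 0 ∨ c + b < 0 := by
  by_contra! h
  nlinarith [mul_nonneg h.1 h.2, mul_pos ha hc, mul_pos ha (neg_pos.2 hb),
    mul_nonneg h.1 (neg_pos.2 hb).le, mul_nonneg h.2 ha.le]

/-- From a form with outer coefficients of equal sign, one step leads to a river edge or to a form
with smaller outer coefficients. -/
theorem exists_step_descent {f : IntForm} (hf : ¬ IsSquare f.disc) (hD : 0 < f.disc) :
    f.Simple ∨ f.swap.Simple ∨ ∃ (s : Bool) (x : Bool),
      ((if s then f.swap else f).step x).Simple ∨ ((if s then f.swap else f).step x).swap.Simple ∨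
      |((if s then f.swap else f).step x).1| + |((if s then f.swap else f).step x).2.2| <
        |f.1| + |f.2.2| := by
  have key : ∀ g : IntForm, ¬ IsSquare g.disc → 0 < g.disc →
      (0 < g.1 ∧ 0 < g.2.2 ∧ g.2.1 < 0 ∨ g.1 < 0 ∧ g.2.2 < 0 ∧ 0 < g.2.1) →
      ∃ x : Bool, (g.step x).Simple ∨ (g.step x).swap.Simple ∨
        |(g.step x).1| + |(g.step x).2.2| < |g.1| + |g.2.2| := by
    rintro ⟨a, b, c⟩ hg hg0 h
    have h0 := sum_ne_zero hg
    simp only [disc] at hg0 h h0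
    rcases h with ⟨ha, hc, hb⟩ | ⟨ha, hc, hb⟩
    · rcases lt_or_gt_of_ne h0 with hu | hu
      · exact ⟨false, .inl ⟨ha, hu⟩⟩
      · rcases disc_pos_or ha hc hg0 hb with h | h
        · refine ⟨false, .inr (.inr ?_)⟩
          simp only [step]
          rw [abs_of_pos ha, abs_of_pos hu, abs_of_pos hc]
          omega
        · refine ⟨true, .inr (.inr ?_)⟩
          simp only [step]
          rw [abs_of_pos ha, abs_of_pos hu, abs_of_pos hc]
          omega
    · rcases lt_or_gt_of_ne h0 with hu | hu
      · rcases disc_pos_or (b := -b) (neg_pos.2 ha) (neg_pos.2 hc) (by nlinarith) (by omega)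
          with h | h
        · refine ⟨false, .inr (.inr ?_)⟩
          simp only [step]
          rw [abs_of_neg ha, abs_of_neg hu, abs_of_neg hc]
          omega
        · refine ⟨true, .inr (.inr ?_)⟩
          simp only [step]
          rw [abs_of_neg ha, abs_of_neg hu, abs_of_neg hc]
          omega
      · exact ⟨false, .inr (.inl ⟨hu, ha⟩)⟩
  have h1 := fst_ne_zero hf
  have h3 := snd_snd_ne_zero hf
  have hb : 0 < f.1 * f.2.2 → f.2.1 ≠ 0 := by
    intro h h0
    simp only [disc, h0] at hD
    nlinarith
  by_cases hs : f.Simple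
  · exact .inl hs
  by_cases hs' : f.swap.Simple
  · exact .inr (.inl hs')
  refine .inr (.inr ?_)
  by_cases hsign : 0 < f.1 ∧ 0 < f.2.2 ∧ f.2.1 < 0 ∨ f.1 < 0 ∧ f.2.2 < 0 ∧ 0 < f.2.1
  · obtain ⟨x, hx⟩ := key f hf hD hsign
    exact ⟨false, x, hx⟩
  -- Since `b ≠ 0`, the labels shrink in one of the two directions of the edge; reversal changes the
  -- sign of `b`.
  · have hsign' : 0 < f.swap.1 ∧ 0 < f.swap.2.2 ∧ f.swap.2.1 < 0 ∨
        f.swap.1 < 0 ∧ f.swap.2.2 < 0 ∧ 0 < f.swap.2.1 := by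
      simp only [Simple, swap] at hs hs' ⊢
      have hb' : 0 < f.1 ∧ 0 < f.2.2 ∨ f.1 < 0 ∧ f.2.2 < 0 → f.2.1 ≠ 0 := fun h =>
        hb (h.elim (fun h => mul_pos h.1 h.2) fun h => mul_pos_of_neg_of_neg h.1 h.2)
      omega
    obtain ⟨x, hx⟩ := key f.swap (by rwa [disc_swap]) (by rwa [disc_swap]) hsign'
    exact ⟨true, x, by rwa [if_pos rfl, add_comm |f.1|]⟩

theorem Simple.not_simple_swap {f : IntForm} (hf : f.Simple) : ¬ f.swap.Simple := fun h =>
  lt_asymm hf.1 h.2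

theorem SameSigns.not_simple {f : IntForm} (hf : f.SameSigns) : ¬ f.Simple := by
  simp only [SameSigns, Simple] at *
  omega

theorem SameSigns.not_simple_swap {f : IntForm} (hf : f.SameSigns) : ¬ f.swap.Simple := by
  simp only [SameSigns, Simple, swap] at *
  omega

/-- Moving backwards along the river, one never meets a rightward river edge. -/
theorem River.not_simple_act_swap {f : IntForm} (hf : f.River) (w : List Bool) :
    ¬ (f.swap.act w).Simple := by
  -- Changing all signs turns the reversed edge, with form `[c, -b, a]`, into the river form `[-c,
  -- b, -a]`, to which `River.act_eq` applies.
  have hg : River ((-1 : ℤ) • f.swap : IntForm) := by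
    obtain ⟨⟨h1, h2⟩, h3⟩ := hf
    refine ⟨⟨?_, ?_⟩, ?_⟩
    · simpa [swap] using h2
    · simpa [swap] using h1
    · convert h3 using 2
      rw [← disc_swap f]
      simp [disc]
  have e : f.swap.act w = (-1 : ℤ) • ((-1 : ℤ) • f.swap : IntForm).act w := by
    rw [act_smul, smul_smul]
    simp
  rw [e]
  rcases hg.act_eq w with h | h
  · rw [h]
    intro hs
    have h1 := (hg.iterate w.length).1.1
    have h2 : 0 < -1 * _ := hs.1
    omega
  · simp only [SameSigns, Simple, Prod.smul_def, smul_eq_mul] at h ⊢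
    omega

theorem River.exists_iterate_eq {f : IntForm} (hf : f.River) (k : ℕ) :
    ∃ j, IntForm.next^[j] (IntForm.next^[k] f) = f := by
  obtain ⟨n, hn, h⟩ := hf.mem_periodicPts
  -- These steps complete `k` full rounds of length `n`; the subtraction is not truncated because
  -- `n` is positive.
  refine ⟨n * k - k, ?_⟩
  rw [← Function.iterate_add_apply, Nat.sub_add_cancel (Nat.le_mul_of_pos_left k hn)]
  exact h.mul_const k

end IntForm

/-! ### Invariants of a topograph, existence and connectedness of its river. -/

namespace Topograph

open PlaneCubicTree

variable {T : Topograph}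

theorem vertexLabel_zero (d : T.tree.G.Dart) : T.vertexLabel d 0 = (T.config d).1 := rfl

/-- The third region at the vertex `d.fst` is the one behind `d`. -/
theorem vertexLabel_one (d : T.tree.G.Dart) :
    T.vertexLabel d 1 = (T.config d).1 + (T.config d).2.2 - (T.config d).2.1 := by
  have h : T.vertexLabel d 1 = (T.config (T.tree.right (T.tree.rev d))).1 := by
    simp [vertexLabel, config, right_apply]
  rw [h, config_right, config_rev]
  simp only [IntForm.step, IntForm.swap]
  ring

theorem vertexLabel_two (d : T.tree.G.Dart) : T.vertexLabel d 2 = (T.config d).2.2 := by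
  have h : T.vertexLabel d 2 = (T.config (T.tree.left (T.tree.rev d))).1 := by
    simp [vertexLabel, config, left_apply, pow_two]
  rw [h, config_left, config_rev]
  rfl

theorem hasDiscriminant_iff {D : ℤ} :
    T.HasDiscriminant D ↔ ∀ d, IntForm.disc (T.config d) = D := by
  refine forall_congr' fun d => ?_
  rw [vertexLabel_zero, vertexLabel_one, vertexLabel_two, eq_comm, IntForm.disc]
  constructor <;> intro h <;> linarith

theorem isPrimitive_iff : T.IsPrimitive ↔ ∀ d, IntForm.Primitive (T.config d) := by
  refine forall_congr' fun d => ?_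
  rw [vertexLabel_zero, vertexLabel_one, vertexLabel_two, IntForm.Primitive]
  obtain ⟨a, b, c⟩ := T.config d
  simp only
  constructor
  · intro h n h1 h2 h3
    have : n ∣ (Int.gcd (Int.gcd a (a + c - b)) c : ℤ) :=
      Int.dvd_coe_gcd (Int.dvd_coe_gcd h1 ((h1.add h3).sub h2)) h3
    rw [h] at this
    exact isUnit_of_dvd_one this
  · intro h
    have h3 := Int.gcd_dvd_right (Int.gcd a (a + c - b)) c
    have h0 := Int.gcd_dvd_left (Int.gcd a (a + c - b)) c
    have h1 := h0.trans (Int.gcd_dvd_left a (a + c - b))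
    have h2 := h0.trans (Int.gcd_dvd_right a (a + c - b))
    have hb := (h1.add h3).sub h2
    rw [sub_sub_cancel] at hb
    simpa [Int.isUnit_iff_natAbs_eq] using h _ h1 hb h3

theorem isRiverSequence_iff {d : T.tree.G.Dart} {w : List Bool} :
    T.IsRiverSequence d w ↔ IntForm.IsRiverSequence (T.config d) w := by
  simp only [IsRiverSequence, IntForm.IsRiverSequence, ← config_follow]
  rfl

theorem config_cases (d e : T.tree.G.Dart) :
    ∃ f ∈ ({T.config d, IntForm.swap (T.config d)} : Set IntForm), ∃ w,
      T.config e = f.act w ∨ T.config e = (f.act w).swap := by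
  obtain ⟨w, h | h | h | h⟩ := exists_follow d e
  · exact ⟨_, .inl rfl, w, .inl (by rw [h, config_follow])⟩
  · exact ⟨_, .inl rfl, w, .inr (by rw [h, config_rev, config_follow])⟩
  · exact ⟨_, .inr rfl, w, .inl (by rw [h, config_follow, config_rev])⟩
  · exact ⟨_, .inr rfl, w, .inr (by rw [h, config_rev, config_follow, config_rev])⟩

theorem hasDiscriminant_disc (d : T.tree.G.Dart) :
    T.HasDiscriminant (IntForm.disc (T.config d)) := by
  refine hasDiscriminant_iff.2 fun e => ?_
  obtain ⟨f, rfl | rfl, w, h | h⟩ := config_cases d e <;> simp [h]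

theorem isPrimitive_of_config {d : T.tree.G.Dart} (hd : IntForm.Primitive (T.config d)) :
    T.IsPrimitive := by
  refine isPrimitive_iff.2 fun e => ?_
  obtain ⟨f, rfl | rfl, w, h | h⟩ := config_cases d e
  · exact h ▸ hd.act w
  · exact h ▸ (hd.act w).swap
  · exact h ▸ hd.swap.act w
  · exact h ▸ (hd.swap.act w).swap

theorem nonempty_dart (T : PlaneCubicTree) : Nonempty T.G.Dart := by
  obtain ⟨v⟩ := T.isTree.connected.nonempty
  obtain ⟨u, hu⟩ := Set.nonempty_of_ncard_ne_zero (s := T.G.neighborSet v)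
    (by rw [T.degree_three]; omega)
  exact ⟨⟨(v, u), hu⟩⟩

/-- The river exists. -/
theorem exists_isRiverEdge {D : ℤ} (hD : 0 < D) (hs : ¬ IsSquare D) (h : T.HasDiscriminant D) :
    ∃ d, T.IsRiverEdge d := by
  rw [hasDiscriminant_iff] at h
  have hstep : ∀ e x, IntForm.Simple (IntForm.step (T.config e) x) ∨
      IntForm.Simple (IntForm.swap (IntForm.step (T.config e) x)) → ∃ d, T.IsRiverEdge d := by
    intro e x he
    rw [← config_step, ← config_rev] at he
    exact he.elim (fun he => ⟨_, he⟩) fun he => ⟨_, he⟩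
  -- Induction on a bound for `|a| + |c|`, which the descent step lowers until the river is met.
  have key : ∀ (n : ℕ) (d : T.tree.G.Dart), |(T.config d).1| + |(T.config d).2.2| < n →
      ∃ e, T.IsRiverEdge e := by
    intro n
    induction n with
    | zero =>
      intro d hd
      have := abs_nonneg (T.config d).1
      have := abs_nonneg (T.config d).2.2
      simp only [Nat.cast_zero] at hd
      omega
    | succ n ih =>
      intro d hd
      rcases IntForm.exists_step_descent (f := T.config d) (by rwa [h d]) (by rwa [h d]) with
        hd' | hd' | ⟨s, x, hd'⟩
      · exact ⟨d, hd'⟩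
      · rw [← config_rev] at hd'
        exact ⟨_, hd'⟩
      · have hc : (if s = true then IntForm.swap (T.config d) else T.config d) =
            T.config (if s = true then T.tree.rev d else d) := by
          cases s
          · rfl
          · exact (config_rev d).symm
        rw [hc] at hd'
        rcases hd' with hd' | hd' | hd'
        · exact hstep _ _ (.inl hd')
        · exact hstep _ _ (.inr hd')
        · rw [← config_step] at hd'
          refine ih (step (if s = true then T.tree.rev d else d) x) ?_
          push_cast at hd
          omega
  obtain ⟨d⟩ := nonempty_dart T.tree
  refine key ((|(T.config d).1| + |(T.config d).2.2|).toNat + 1) d ?_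
  push_cast
  omega

/-- The river is connected. -/
theorem exists_iterate_next_eq {d e : T.tree.G.Dart} (hd : IntForm.River (T.config d))
    (he : IntForm.River (T.config e)) : ∃ k, T.config e = IntForm.next^[k] (T.config d) := by
  have forward : ∀ {d e : T.tree.G.Dart} (w : List Bool), IntForm.River (T.config d) →
      IntForm.River (T.config e) → e = follow d w →
      T.config e = IntForm.next^[w.length] (T.config d) := by
    rintro d _ w hd he rfl
    rw [config_follow] at he ⊢
    exact (hd.act_eq w).resolve_right fun h => h.not_simple he.1
  obtain ⟨w, h | h | h | h⟩ := exists_follow d e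
  · exact ⟨_, forward w hd he h⟩
  -- Forward from `d` there are only rightward river edges and edges off the river, so the reverse
  -- of such an edge is never a rightward river edge.
  · exfalso
    have h1 := he.1
    rw [h, config_rev, config_follow] at h1
    rcases hd.act_eq w with h2 | h2
    · rw [h2] at h1
      exact (hd.iterate _).1.not_simple_swap h1
    · exact h2.not_simple_swap h1
  · exfalso
    have h1 := he.1
    rw [h, config_follow, config_rev] at h1
    exact hd.not_simple_act_swap w h1
  -- Here `e` lies behind `d` on the river. Following the path back, `d` is reached from `e` going
  -- forward, and periodicity turns this into a number of steps from the form at `d` to that at `e`.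
  · obtain ⟨u, hu⟩ := exists_follow_rev (T.tree.rev d) w
    rw [← h, rev_rev] at hu
    obtain ⟨j, hj⟩ := he.exists_iterate_eq u.length
    exact ⟨j, by rw [forward u he hd hu.symm, hj]⟩

theorem Same.exists_config_eq {T T' : Topograph} (h : T.Same T') (d : T.tree.G.Dart) :
    ∃ d' : T'.tree.G.Dart, T'.config d' = T.config d := by
  obtain ⟨φ, h1, h2⟩ := h
  have e1 : T'.label (rightRegion (φ.toHom.mapDart d)) = T.label (rightRegion d) := h2 (T.tree.rev d)
  have e2 : T'.label (aheadRegion (φ.toHom.mapDart d)) = T.label (aheadRegion d) := by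
    rw [aheadRegion, aheadRegion, ← h2, right_apply, right_apply, h1]
    rfl
  exact ⟨φ.toHom.mapDart d, by rw [config, config, edgeLabel, edgeLabel, h2, e1, e2]⟩

end Topograph

/-! ### The necklace of a topograph and the bijection. -/

namespace PrimitiveNonsquareTopograph

open Topograph PlaneCubicTree

theorem primitive (T : PrimitiveNonsquareTopograph) (d : T.1.tree.G.Dart) :
    IntForm.Primitive (T.1.config d) := isPrimitive_iff.1 T.2.1 d

theorem river (T : PrimitiveNonsquareTopograph) {d : T.1.tree.G.Dart} (hd : T.1.IsRiverEdge d) :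
    IntForm.River (T.1.config d) := by
  obtain ⟨D, -, hs, h⟩ := T.2.2
  exact ⟨hd, by rwa [hasDiscriminant_iff.1 h d]⟩

theorem exists_isRiverEdge (T : PrimitiveNonsquareTopograph) : ∃ d, T.1.IsRiverEdge d := by
  obtain ⟨D, hD, hs, h⟩ := T.2.2
  exact Topograph.exists_isRiverEdge hD hs h

/-- The necklace of the river sequences. -/
noncomputable def necklace (T : PrimitiveNonsquareTopograph) : NonrepeatingNecklace :=
  ⟨(IntForm.riverWord (T.1.config T.exists_isRiverEdge.choose) : Cycle Bool),
    (T.river T.exists_isRiverEdge.choose_spec).two_le_length,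
    (T.river T.exists_isRiverEdge.choose_spec).not_isRepeating⟩

theorem coe_riverWord (T : PrimitiveNonsquareTopograph) {d : T.1.tree.G.Dart}
    (hd : T.1.IsRiverEdge d) :
    (IntForm.riverWord (T.1.config d) : Cycle Bool) = T.necklace.1 := by
  have he := T.river T.exists_isRiverEdge.choose_spec
  obtain ⟨k, hk⟩ := exists_iterate_next_eq he (T.river hd)
  rw [hk, he.riverWord_iterate]
  exact Cycle.coe_eq_coe.2 (List.IsRotated.forall _ _)

theorem necklace_eq_of_same {T T' : PrimitiveNonsquareTopograph} (h : T.1.Same T'.1) :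
    T.necklace = T'.necklace := by
  obtain ⟨d, hd⟩ := T.exists_isRiverEdge
  obtain ⟨d', hd'⟩ := h.exists_config_eq d
  have hr : T'.1.IsRiverEdge d' := by
    change IntForm.Simple (T'.1.config d')
    rw [hd']
    exact hd
  exact Subtype.ext (by rw [← coe_riverWord T hd, ← coe_riverWord T' hr, hd'])

/-- After moving along one river until the two words agree letter by letter, the same closed path
fixes both primitive simple forms, so they coincide. -/
theorem same_of_necklace_eq {T T' : PrimitiveNonsquareTopograph} (h : T.necklace = T'.necklace) :
    T.1.Same T'.1 := by
  obtain ⟨d, hd⟩ := T.exists_isRiverEdge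
  obtain ⟨d', hd'⟩ := T'.exists_isRiverEdge
  have hr := T.river hd
  have hr' := T'.river hd'
  obtain ⟨k, hk⟩ : IntForm.riverWord (T.1.config d) ~r IntForm.riverWord (T'.1.config d') :=
    Cycle.coe_eq_coe.1 (by rw [coe_riverWord T hd, coe_riverWord T' hd', h])
  have hrk := hr.iterate k
  have he : T.1.config (follow d (IntForm.word (T.1.config d) k)) =
      IntForm.next^[k] (T.1.config d) := by
    rw [config_follow, IntForm.act_word]
  rw [← hr.riverWord_iterate, ← he] at hk
  rw [← he] at hrk
  have hs := hrk.isRiverSequence.2.2.1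
  rw [hk] at hs
  exact same_of_config_eq _ _ (IntForm.eq_of_act_eq hrk.1 hr'.1 (T.primitive _) (T'.primitive _)
    hr'.isRiverSequence.1 hs hr'.isRiverSequence.2.2.1)

theorem exists_necklace_eq (N : NonrepeatingNecklace) :
    ∃ T : PrimitiveNonsquareTopograph, T.necklace = N := by
  obtain ⟨N, h2, h⟩ := N
  induction N using Quotient.inductionOn with | _ w => ?_
  obtain ⟨f, hp, hr, hD, hw⟩ := IntForm.exists_riverWord_eq h2 h
  have hc := config_ofFormDart f
  have hedge : (ofForm f).IsRiverEdge (ofFormDart f) := by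
    change IntForm.Simple ((ofForm f).config (ofFormDart f))
    rw [hc]
    exact hr.1
  have hprim : (ofForm f).IsPrimitive := isPrimitive_of_config (d := ofFormDart f) (by rwa [hc])
  have hdisc : (ofForm f).HasDiscriminant f.disc := by
    have := hasDiscriminant_disc (ofFormDart f)
    rwa [hc] at this
  let T : PrimitiveNonsquareTopograph := ⟨ofForm f, hprim, f.disc, hD, And.right hr, hdisc⟩
  refine ⟨T, Subtype.ext ((coe_riverWord T (d := ofFormDart f) hedge).symm.trans ?_)⟩
  change (IntForm.riverWord ((ofForm f).config (ofFormDart f)) : Cycle Bool) = _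
  rw [hc, hw]
  rfl

end PrimitiveNonsquareTopograph

theorem theorem8p11 :
    ∃ Φ : Quotient PrimitiveNonsquareTopograph.setoid → NonrepeatingNecklace,
      Function.Bijective Φ ∧
      ∀ T : PrimitiveNonsquareTopograph,
        (∃ d : T.1.tree.G.Dart, T.1.IsRiverEdge d) ∧
        ∀ d : T.1.tree.G.Dart, T.1.IsRiverEdge d →
          ∃ w : List Bool, T.1.IsRiverSequence d w ∧
            (∀ w' : List Bool, T.1.IsRiverSequence d w' → w' = w) ∧
            (w : Cycle Bool) = (Φ (Quotient.mk _ T)).1 := by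
  refine ⟨Quotient.lift PrimitiveNonsquareTopograph.necklace fun T T' h =>
    PrimitiveNonsquareTopograph.necklace_eq_of_same h, ⟨?_, ?_⟩, fun T =>
    ⟨T.exists_isRiverEdge, fun d hd => ⟨_, Topograph.isRiverSequence_iff.2
      (T.river hd).isRiverSequence, fun w' hw' => (T.river hd).eq_riverWord
        (Topograph.isRiverSequence_iff.1 hw'), T.coe_riverWord hd⟩⟩⟩
  · intro q q'
    induction q using Quotient.inductionOn
    induction q' using Quotient.inductionOn
    exact fun h => Quotient.sound (PrimitiveNonsquareTopograph.same_of_necklace_eq h)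
  · intro N
    obtain ⟨T, hT⟩ := PrimitiveNonsquareTopograph.exists_necklace_eq N
    exact ⟨Quotient.mk _ T, hT⟩
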